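/- Let $\mathbb N=\{1,2,3,\dots\}$ and, for $j\in\mathbb N$, let $S_j(x)=3^{-j}x+1-3^{-(j-1)}$ for $x\in\mathbb R$. Let $P$ be the unique Borel probability measure on $\mathbb R$ with $P=\sum_{j\ge 1}2^{-j}\,P\circ S_j^{-1}$. For a finite word $\omega=\omega_1\cdots\omega_k$ over $\mathbb N$ put $S_\omega=S_{\omega_1}\circ\cdots\circ S_{\omega_k}$, $J_\omega=S_\omega([0,1])$ and $p_\omega=2^{-(\omega_1+\cdots+\omega_k)}$. If $k\ge 1$ and $j\in\mathbb N$, let $\omega^-(\omega_k+j)$ denote the word $\omega_1\cdots\omega_{k-1}(\omega_k+j)$, and put $J_{(\omega,\infty)}=\bigcup_{j\ge 1}J_{\omega^-(\omega_k+j)}$. Let $a(\omega)=\frac{1}{P(J_\omega)}\int_{J_\omega}x\,dP(x)$ and $a(\omega,\infty)=\frac{1}{P(J_{(\omega,\infty)})}\int_{J_{(\omega,\infty)}}x\,dP(x)$ be the conditional means of $P$ on these sets. For a set $\alpha\subset\mathbb R$ with finitely many points and at least one, let $V(P;\alpha)=\int\min_{a\in\alpha}(x-a)^2\,dP(x)$.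 For $n\ge 1$ let $V_n=\inf\{V(P;\alpha):1\le\operatorname{card}(\alpha)\le n\}$. A set $\alpha$ with at most $n$ points and $V(P;\alpha)=V_n$ is called an optimal set of $n$-means for $P$. Let $n\ge 2$ and let $\ell=\ell(n)\in\mathbb N$ be the number with $2^{\ell}\le n<2^{\ell+1}$. Put $$\alpha(\ell)=\{a(\omega):p_\omega=2^{-\ell}\}\cup\{a(\omega,\infty):p_\omega=2^{-\ell}\},$$ and for $I\subset\alpha(\ell)$ with $\operatorname{card}(I)=n-2^{\ell}$ put $$\alpha_n(I)=(\alpha(\ell)\setminus I)\cup\{a(\omega1),\,a(\omega1,\infty):a(\omega)\in I\}\cup\{a(\omega^-(\omega_k+1)),\,a(\omega^-(\omega_k+1),\infty):a(\omega,\infty)\in I\},$$ where $k$ is the length of $\omega$. Theorem. For every $n\ge 2$ and every $I\subset\alpha(\ell(n))$ with $\operatorname{card}(I)=n-2^{\ell(n)}$, the set $\alpha_n(I)$ is an optimal set of $n$-means for $P$. The $n$th quantization error is $$V_n=\frac{1}{18^{\ell(n)}}\cdot\frac18\Big(2^{\ell(n)+1}-n+\frac19\big(n-2^{\ell(n)}\big)\Big).$$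 The number of distinct sets $\alpha_n(I)$, as $I$ runs over the subsets of $\alpha(\ell(n))$ with $n-2^{\ell(n)}$ elements, is $\binom{2^{\ell(n)}}{n-2^{\ell(n)}}$. -/

import Mathlib

open MeasureTheory
open scoped ENNReal

namespace CantorQuantization

/-! ### The infinite iterated function system and its invariant measure -/

/-- The similarity `S_j(x) = 3^{-j} x + 1 - 3^{-(j-1)}`, for `j = 1, 2, …`. -/
noncomputable def S (j : ℕ+) (x : ℝ) : ℝ :=
  1 / 3 ^ (j : ℕ) * x + 1 - 1 / 3 ^ ((j : ℕ) - 1)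

/-- `P` is a Borel probability measure on `ℝ` with `P = ∑_{j ≥ 1} 2^{-j} P ∘ S_j⁻¹`. -/
def IsInvariant (P : Measure ℝ) : Prop :=
  IsProbabilityMeasure P ∧
    P = Measure.sum fun j : ℕ+ => ((1 / 2 : ℝ≥0∞) ^ (j : ℕ)) • P.map (S j)

theorem continuous_S (j : ℕ+) : Continuous (S j) := by
  unfold S; fun_prop

theorem measurable_S (j : ℕ+) : Measurable (S j) := (continuous_S j).measurable

theorem tsum_weight : ∑' j : ℕ+, (1 / 2 : ℝ≥0∞) ^ (j : ℕ) = 1 := by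
  rw [tsum_pnat_eq_tsum_succ (f := fun n => (1 / 2 : ℝ≥0∞) ^ n)]
  simp only [pow_succ, ENNReal.tsum_mul_right, ENNReal.tsum_geometric, one_div,
    ENNReal.one_sub_inv_two, inv_inv]
  exact ENNReal.mul_inv_cancel (by simp) (by simp)

instance : MeasurableSpace ℕ+ := ⊤

instance : DiscreteMeasurableSpace ℕ+ := ⟨fun _ => trivial⟩

instance : BorelSpace ℕ+ :=
  ⟨by rw [borel_eq_top_of_discrete]; rfl⟩

/-- The law of one letter. -/
noncomputable def letterLaw : Measure ℕ+ :=
  Measure.sum fun j : ℕ+ => ((1 / 2 : ℝ≥0∞) ^ (j : ℕ)) • Measure.dirac j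

instance : IsProbabilityMeasure letterLaw := ⟨by
  simp only [letterLaw, Measure.sum_apply _ MeasurableSet.univ, Measure.smul_apply,
    measure_univ, smul_eq_mul, mul_one]
  exact tsum_weight⟩

/-- The law of an infinite word with independent letters. -/
noncomputable def wordLaw : Measure (ℕ → ℕ+) := Measure.infinitePi fun _ => letterLaw

instance : IsProbabilityMeasure wordLaw := by unfold wordLaw; infer_instance

/-- Prefix a letter to an infinite word. -/
def prefixLetter (j : ℕ+) (w : ℕ → ℕ+) : ℕ → ℕ+
  | 0 => j
  | n + 1 => w n

theorem measurable_prefixLetter (j : ℕ+) : Measurable (prefixLetter j) := by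
  refine measurable_pi_iff.2 fun n => ?_
  cases n with
  | zero => exact measurable_const
  | succ n => exact measurable_pi_apply n

theorem wordLaw_eq :
    wordLaw = Measure.sum fun j : ℕ+ =>
      ((1 / 2 : ℝ≥0∞) ^ (j : ℕ)) • wordLaw.map (prefixLetter j) := by
  symm
  refine Measure.eq_infinitePi _ fun s t ht => ?_
  classical
  -- it suffices to treat initial segments of indices
  obtain ⟨N, hN⟩ : ∃ N, s ⊆ Finset.range (N + 1) := by
    obtain ⟨N, hN⟩ := s.exists_nat_subset_range
    exact ⟨N, hN.trans (Finset.range_mono (Nat.le_succ N))⟩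
  set u : ℕ → Set ℕ+ := fun i => if i ∈ s then t i else Set.univ with hu
  have hum : ∀ i, MeasurableSet (u i) := fun i => MeasurableSet.of_discrete
  have h1 : Set.pi (s : Set ℕ) t = Set.pi (Finset.range (N + 1) : Set ℕ) u := by
    ext w
    simp only [Set.mem_pi, Finset.mem_coe, hu]
    constructor
    · intro h i _
      by_cases hi : i ∈ s <;> simp [hi, h]
    · intro h i hi
      have := h i (hN hi)
      simpa [hi] using this
  have h2 : ∏ i ∈ s, letterLaw (t i) = ∏ i ∈ Finset.range (N + 1), letterLaw (u i) := by
    rw [← Finset.prod_subset hN]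
    · refine Finset.prod_congr rfl fun i hi => ?_
      simp [hu, hi]
    · intro i _ hi
      simp [hu, hi]
  rw [h1, h2, Finset.prod_range_succ']
  have hms : MeasurableSet (Set.pi (Finset.range (N + 1) : Set ℕ) u) :=
    MeasurableSet.pi (Finset.countable_toSet _) fun i _ => hum i
  have h3 : ∀ j : ℕ+, wordLaw.map (prefixLetter j) (Set.pi (Finset.range (N + 1) : Set ℕ) u) =
      (∏ i ∈ Finset.range N, letterLaw (u (i + 1))) * Measure.dirac j (u 0) := by
    intro j
    rw [Measure.map_apply (measurable_prefixLetter j) hms]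
    by_cases hj : j ∈ u 0
    · have : prefixLetter j ⁻¹' (Set.pi (Finset.range (N + 1) : Set ℕ) u) =
          Set.pi (Finset.range N : Set ℕ) fun i => u (i + 1) := by
        ext w
        simp only [Set.mem_preimage, Set.mem_pi, Finset.coe_range, Set.mem_Iio]
        constructor
        · intro h i hi
          exact h (i + 1) (by omega)
        · intro h i hi
          cases i with
          | zero => exact hj
          | succ i => exact h i (by omega)
      rw [this, wordLaw, Measure.infinitePi_pi _ fun i _ => hum _]
      simp [hj]
    · have : prefixLetter j ⁻¹' (Set.pi (Finset.range (N + 1) : Set ℕ) u) = ∅ := by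
        ext w
        simp only [Set.mem_preimage, Set.mem_pi, Finset.coe_range, Set.mem_Iio,
          Set.mem_empty_iff_false, iff_false]
        intro h
        exact hj (h 0 (by omega))
      rw [this]
      simp [hj]
  rw [Measure.sum_apply _ hms]
  simp only [Measure.smul_apply, h3, smul_eq_mul]
  rw [letterLaw, Measure.sum_apply _ (hum 0), ← letterLaw, ← ENNReal.tsum_mul_left]
  refine tsum_congr fun j => ?_
  simp only [Measure.smul_apply, smul_eq_mul]
  ring

/-- The general term of the coding map. -/
noncomputable def codeTerm (n : ℕ) (w : ℕ → ℕ+) : ℝ :=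
  1 / 3 ^ (∑ i ∈ Finset.range n, (w i : ℕ)) * (1 - 1 / 3 ^ ((w n : ℕ) - 1))

/-- The coding map: the point of `[0, 1]` with a given infinite word as address. -/
noncomputable def code (w : ℕ → ℕ+) : ℝ := ∑' n, codeTerm n w

theorem norm_codeTerm_le (n : ℕ) (w : ℕ → ℕ+) : ‖codeTerm n w‖ ≤ (1 / 3 : ℝ) ^ n := by
  have h1 : n ≤ ∑ i ∈ Finset.range n, (w i : ℕ) := by
    calc n = ∑ i ∈ Finset.range n, 1 := by simp
      _ ≤ _ := Finset.sum_le_sum fun i _ => (w i).pos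
  have h2 : (1 / 3 : ℝ) ^ (∑ i ∈ Finset.range n, (w i : ℕ)) ≤ (1 / 3 : ℝ) ^ n :=
    pow_le_pow_of_le_one (by norm_num) (by norm_num) h1
  have h3 : (1 / 3 : ℝ) ^ ((w n : ℕ) - 1) ≤ 1 := pow_le_one₀ (by norm_num) (by norm_num)
  have h4 : (0 : ℝ) ≤ (1 / 3 : ℝ) ^ ((w n : ℕ) - 1) := by positivity
  have h5 : (0 : ℝ) ≤ (1 / 3 : ℝ) ^ (∑ i ∈ Finset.range n, (w i : ℕ)) := by positivity
  have h6 : codeTerm n w =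
      (1 / 3 : ℝ) ^ (∑ i ∈ Finset.range n, (w i : ℕ)) * (1 - (1 / 3 : ℝ) ^ ((w n : ℕ) - 1)) := by
    simp only [codeTerm, one_div_pow]
  rw [h6, Real.norm_eq_abs, abs_of_nonneg (mul_nonneg h5 (by linarith))]
  nlinarith

theorem summable_code (w : ℕ → ℕ+) : Summable fun n => codeTerm n w :=
  Summable.of_norm_bounded (summable_geometric_of_lt_one (by norm_num) (by norm_num))
    fun n => norm_codeTerm_le n w

theorem measurable_code : Measurable code := by
  have : Continuous code := by
    refine continuous_tsum (fun n => ?_)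
      (summable_geometric_of_lt_one (r := (1 / 3 : ℝ)) (by norm_num) (by norm_num))
      fun n w => norm_codeTerm_le n w
    unfold codeTerm
    refine Continuous.mul ?_ ?_
    · have : Continuous fun w : ℕ → ℕ+ => ∑ i ∈ Finset.range n, (w i : ℕ) :=
        continuous_finsetSum _ fun i _ => continuous_of_discreteTopology.comp (continuous_apply i)
      exact (continuous_of_discreteTopology (f := fun k : ℕ => (1 / 3 ^ k : ℝ))).comp this
    · exact (continuous_of_discreteTopology
        (f := fun k : ℕ+ => (1 - 1 / 3 ^ ((k : ℕ) - 1) : ℝ))).comp (continuous_apply n)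
  exact this.measurable

theorem code_prefixLetter (j : ℕ+) (w : ℕ → ℕ+) : code (prefixLetter j w) = S j (code w) := by
  rw [code, (summable_code _).tsum_eq_zero_add]
  have h : ∀ n, codeTerm (n + 1) (prefixLetter j w) = 1 / 3 ^ (j : ℕ) * codeTerm n w := by
    intro n
    simp only [codeTerm, Finset.sum_range_succ', prefixLetter]
    rw [pow_add]
    field_simp
  simp only [h, tsum_mul_left]
  simp only [codeTerm, prefixLetter, S, code, Finset.range_zero, Finset.sum_empty, pow_zero]
  ring

theorem exists_isInvariant : ∃ P : Measure ℝ, IsInvariant P := by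
  refine ⟨wordLaw.map code, Measure.isProbabilityMeasure_map measurable_code.aemeasurable, ?_⟩
  conv_lhs => rw [wordLaw_eq]
  rw [Measure.map_sum measurable_code.aemeasurable]
  congr 1
  funext j
  rw [Measure.map_smul, Measure.map_map measurable_code (measurable_prefixLetter j),
    Measure.map_map (measurable_S j) measurable_code]
  congr 2
  funext w
  exact code_prefixLetter j w

theorem charFun_map_S (P : Measure ℝ) (j : ℕ+) (t : ℝ) :
    charFun (P.map (S j)) t =
      charFun P (1 / 3 ^ (j : ℕ) * t) *
        Complex.exp (inner ℝ (1 - 1 / 3 ^ ((j : ℕ) - 1) : ℝ) t * Complex.I) := by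
  have h : S j = (fun x => x + (1 - 1 / 3 ^ ((j : ℕ) - 1) : ℝ)) ∘ fun x => 1 / 3 ^ (j : ℕ) * x := by
    funext x
    simp only [S, Function.comp]
    ring
  rw [h, ← Measure.map_map (by fun_prop) (by fun_prop), charFun_map_add_const, charFun_map_mul]

theorem hasSum_charFun {P : Measure ℝ} (hP : IsInvariant P) (t : ℝ) :
    HasSum (fun j : ℕ+ => ((1 / 2 : ℝ) ^ (j : ℕ)) • charFun (P.map (S j)) t) (charFun P t) := by
  have := hP.1
  have hint : Integrable (fun x : ℝ => Complex.exp (inner ℝ x t * Complex.I)) P := by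
    refine (integrable_const (1 : ℝ)).mono' (by fun_prop) (Filter.Eventually.of_forall fun x => ?_)
    rw [Complex.norm_exp_ofReal_mul_I]
  have hP2 := hP.2
  rw [hP2] at hint
  have h := hasSum_integral_measure hint
  rw [← hP2] at h
  have e : (fun j : ℕ+ => ((1 / 2 : ℝ) ^ (j : ℕ)) • charFun (P.map (S j)) t) = fun j : ℕ+ =>
      ∫ x : ℝ, Complex.exp (inner ℝ x t * Complex.I)
        ∂(((1 / 2 : ℝ≥0∞) ^ (j : ℕ)) • P.map (S j)) := by
    funext j
    rw [integral_smul_measure, charFun_apply]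
    simp
  rw [e]
  exact h

theorem existsUnique_isInvariant : ∃! P : Measure ℝ, IsInvariant P := by
  obtain ⟨P, hP⟩ := exists_isInvariant
  refine ⟨P, hP, fun Q hQ => ?_⟩
  have := hP.1
  have := hQ.1
  set D : ℝ → ℂ := fun t => charFun Q t - charFun P t with hD
  have hD0 : D 0 = 0 := by simp [hD]
  have hDc : Continuous D := continuous_charFun.sub continuous_charFun
  have step : ∀ r c : ℝ, (∀ t, |t| ≤ r → ‖D t‖ ≤ c) → ∀ t, |t| ≤ 3 * r → ‖D t‖ ≤ c := by
    intro r c h t ht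
    have hsum := (hasSum_charFun hQ t).sub (hasSum_charFun hP t)
    have hw : HasSum (fun j : ℕ+ => (1 / 2 : ℝ) ^ (j : ℕ) * c) (1 * c) := by
      refine HasSum.mul_right c ?_
      have h1 : HasSum (fun j : ℕ+ => ((1 / 2 : ℝ≥0∞) ^ (j : ℕ)).toReal)
          (∑' j : ℕ+, (1 / 2 : ℝ≥0∞) ^ (j : ℕ)).toReal := by
        rw [ENNReal.tsum_toReal_eq fun j => by simp]
        refine ENNReal.hasSum_toReal ?_
        rw [tsum_weight]
        simp
      rw [tsum_weight] at h1
      simpa using h1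
    rw [one_mul] at hw
    rw [hD]
    refine hsum.norm_le_of_bounded hw fun j => ?_
    rw [← smul_sub, charFun_map_S, charFun_map_S, ← sub_mul, norm_smul, norm_mul,
      Complex.norm_exp_ofReal_mul_I, mul_one, Real.norm_of_nonneg (by positivity)]
    refine mul_le_mul_of_nonneg_left (h _ ?_) (by positivity)
    rw [abs_mul, abs_of_nonneg (by positivity : (0 : ℝ) ≤ 1 / 3 ^ (j : ℕ))]
    have h3 : (1 : ℝ) / 3 ^ (j : ℕ) ≤ 1 / 3 := by
      rw [← one_div_pow]
      exact pow_le_of_le_one (by norm_num) (by norm_num) j.ne_zero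
    nlinarith [abs_nonneg t]
  have key : ∀ t, D t = 0 := by
    intro t
    refine norm_le_zero_iff.1 (le_of_forall_pos_le_add fun ε hε => ?_)
    rw [zero_add]
    obtain ⟨δ, hδ, hb⟩ := Metric.continuous_iff.1 hDc 0 ε hε
    have all : ∀ n : ℕ, ∀ t, |t| ≤ 3 ^ n * (δ / 2) → ‖D t‖ ≤ ε := by
      intro n
      induction n with
      | zero =>
        intro t ht
        have := hb t (by rw [Real.dist_0_eq_abs]; linarith)
        rw [hD0, dist_zero_right] at this
        exact this.le
      | succ n ih =>
        intro t ht
        exact step _ _ ih t (by rw [pow_succ] at ht; linarith)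
    obtain ⟨n, hn⟩ := pow_unbounded_of_one_lt (|t| / (δ / 2)) (by norm_num : (1 : ℝ) < 3)
    exact all n t (by rw [div_lt_iff₀ (by linarith)] at hn; exact hn.le)
  refine Measure.ext_of_charFun (funext fun t => ?_)
  exact sub_eq_zero.1 (key t)

/-- The measure `P` generated by the system: the unique Borel probability measure on `ℝ` with
`P = ∑_{j ≥ 1} 2^{-j} P ∘ S_j⁻¹`. -/
noncomputable def P : Measure ℝ := existsUnique_isInvariant.choose

theorem isInvariant_P : IsInvariant P := existsUnique_isInvariant.choose_spec.1

/-! ### Words, cylinders and conditional expectations -/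

/-- `S_ω = S_{ω₁} ∘ ⋯ ∘ S_{ω_k}`; the identity for the empty word. -/
noncomputable def wordMap : List ℕ+ → ℝ → ℝ
  | [] => id
  | j :: w => S j ∘ wordMap w

/-- `p_ω = p_{ω₁} ⋯ p_{ω_k}` with `p_j = 2^{-j}`. -/
noncomputable def wordProb (w : List ℕ+) : ℝ := (w.map fun j => 1 / 2 ^ (j : ℕ)).prod

/-- `J_ω = S_ω([0, 1])`. -/
def cylinder (w : List ℕ+) : Set ℝ := wordMap w '' Set.Icc 0 1

/-- For a nonempty word `ω = ω₁ ⋯ ω_k`, the word `ω⁻(ω_k + j) = ω₁ ⋯ ω_{k-1} (ω_k + j)`.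
(The empty word, for which this operation has no meaning, is left unchanged.) -/
def shiftLast : List ℕ+ → ℕ+ → List ℕ+
  | [], _ => []
  | [i], j => [i + j]
  | i :: k :: w, j => i :: shiftLast (k :: w) j

/-- `J_{(ω, ∞)} = ⋃_{j ≥ 1} J_{ω⁻(ω_k + j)}`. -/
def cylinderTail (w : List ℕ+) : Set ℝ := ⋃ j : ℕ+, cylinder (shiftLast w j)

/-- The conditional expectation `E(X | X ∈ A) = P(A)⁻¹ ∫_A x dP(x)`, where `X` has law `P`. -/
noncomputable def condMean (A : Set ℝ) : ℝ := (P.real A)⁻¹ * ∫ x in A, x ∂P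

/-- `a(ω) = E(X | X ∈ J_ω)`. -/
noncomputable def a (w : List ℕ+) : ℝ := condMean (cylinder w)

/-- `a(ω, ∞) = E(X | X ∈ J_{(ω, ∞)})`. -/
noncomputable def aTail (w : List ℕ+) : ℝ := condMean (cylinderTail w)

/-- `α(ℓ) = {a(ω) : p_ω = 2^{-ℓ}} ∪ {a(ω, ∞) : p_ω = 2^{-ℓ}}`. -/
def alpha (l : ℕ) : Set ℝ :=
  {x | ∃ w : List ℕ+, wordProb w = 1 / 2 ^ l ∧ x = a w} ∪
    {x | ∃ w : List ℕ+, wordProb w = 1 / 2 ^ l ∧ x = aTail w}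

/-- The set `α_n(I)` obtained from `α(ℓ)`, `ℓ = ℓ(n)`, by splitting each point of `I ⊆ α(ℓ)`:
`a(ω)` is replaced by `a(ω1)` and `a(ω1, ∞)`, and `a(ω, ∞)` is replaced by `a(ω⁻(ω_k + 1))` and
`a(ω⁻(ω_k + 1), ∞)`. -/
def alphaSplit (l : ℕ) (I : Set ℝ) : Set ℝ :=
  (alpha l \ I) ∪
    {x | ∃ w : List ℕ+, a w ∈ I ∧ x = a (w ++ [1])} ∪
    {x | ∃ w : List ℕ+, a w ∈ I ∧ x = aTail (w ++ [1])} ∪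
    {x | ∃ w : List ℕ+, w ≠ [] ∧ aTail w ∈ I ∧ x = a (shiftLast w 1)} ∪
    {x | ∃ w : List ℕ+, w ≠ [] ∧ aTail w ∈ I ∧ x = aTail (shiftLast w 1)}

/-! ### Quantization -/

/-- The distortion error `V(μ; α) = ∫ min_{a ∈ α} (x - a)² dμ(x)`, with value in `[0, ∞]`
(it is `∞` for `α = ∅` when `μ ≠ 0`). -/
noncomputable def distortion (μ : Measure ℝ) (α : Set ℝ) : ℝ≥0∞ :=
  ∫⁻ x, ⨅ a ∈ α, ENNReal.ofReal ((x - a) ^ 2) ∂μ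

/-- The `n`th quantization error `V_n(μ) = inf {V(μ; α) : card α ≤ n}`. -/
noncomputable def quantizationError (μ : Measure ℝ) (n : ℕ) : ℝ≥0∞ :=
  ⨅ (α : Set ℝ) (_ : α.encard ≤ n), distortion μ α

/-- `α` is an optimal set of `n`-means for `μ`: it has at most `n` points and attains the infimum
that defines the `n`th quantization error. -/
def IsOptimalSet (μ : Measure ℝ) (n : ℕ) (α : Set ℝ) : Prop :=
  α.encard ≤ n ∧ distortion μ α = quantizationError μ n

end CantorQuantization

namespace CantorQuantization

/-! Let T₀(x) = x/3 and T₁(x) = x/3 + 2/3. Since S_j = T₁^(j-1) ∘ T₀, the invariance equation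
collapses to P = (P∘T₀⁻¹ + P∘T₁⁻¹)/2, so P is the Cantor distribution, with mean 1/2 and variance
1/8. Coding the letter j as j-1 times `true` followed by `false` turns the points a(ω) and a(ω,∞)
with p_ω = 2^{-ℓ}, ℓ ≥ 1, into the midpoints of the 2^ℓ Cantor intervals of level ℓ. Splitting a
point replaces an interval by its two children. An unsplit interval costs at most 18^{-ℓ}/8 and a
split one at most a ninth of that, which gives the upper bound. The points of I are exactly the
level-ℓ midpoints missing from α_n(I), which gives the count.

For the lower bound, the claimed error is convex and piecewise linear in n, so each of its lines
should bound V(P;α) from below for every finite α, whatever its cardinality. This is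
`errorLine_le_distortion`, by induction on the level. If the two outer thirds of [0,1] are served by
disjoint parts of α, then V(P;α) ≥ (V(P;β) + V(P;γ))/18 for rescaled parts β, γ. The lines obey the
same recursion with equality, however the points are shared out. Otherwise, up to the symmetry x ↦
1-x, some a ≥ 1/2 in α has no point of α in (2/3-a, a). Then [2/9, 1/3] is served so badly that
V(P;α) is at least the value of every line (`HasGap.errorLine_le_distortion`). -/

/-! ### The similarities of the Cantor set -/

/-- The two similarities of the ternary Cantor set. -/
noncomputable def binStep (b : Bool) (x : ℝ) : ℝ := x / 3 + if b then 2 / 3 else 0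

/-- The composition of the Cantor similarities along a binary word. -/
noncomputable def binMap : List Bool → ℝ → ℝ
  | [] => id
  | b :: s => binStep b ∘ binMap s

theorem binMap_append (s t : List Bool) : binMap (s ++ t) = binMap s ∘ binMap t := by
  induction s with
  | nil => rfl
  | cons b s ih => simp [binMap, ih, Function.comp_assoc]

theorem measurableEmbedding_affine {u : ℝ} (hu : u ≠ 0) (v : ℝ) :
    MeasurableEmbedding fun x : ℝ => u * x + v := by
  exact ((Homeomorph.mulLeft₀ u hu).trans (Homeomorph.addRight v)).measurableEmbedding

theorem measurableEmbedding_binStep (b : Bool) : MeasurableEmbedding (binStep b) := by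
  have h := measurableEmbedding_affine (u := 1 / 3) (by norm_num) (if b then 2 / 3 else 0)
  convert h using 2 with x
  simp only [binStep]; ring

theorem measurableEmbedding_binMap (s : List Bool) : MeasurableEmbedding (binMap s) := by
  induction s with
  | nil => exact MeasurableEmbedding.id
  | cons b s ih => exact (measurableEmbedding_binStep b).comp ih

theorem binMap_sub (s : List Bool) (x y : ℝ) :
    binMap s x - binMap s y = (x - y) / 3 ^ s.length := by
  induction s with
  | nil => simp [binMap]
  | cons b s ih =>
    simp only [binMap, Function.comp, binStep, List.length_cons, pow_succ]
    rw [add_sub_add_right_eq_sub, ← sub_div, ih, div_div]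

theorem binMap_replicate_true (k : ℕ) (x : ℝ) :
    binMap (List.replicate k true) x = 1 / 3 ^ k * x + 1 - 1 / 3 ^ k := by
  induction k with
  | zero => simp [binMap]
  | succ k ih =>
    simp only [List.replicate_succ, binMap, Function.comp, ih, binStep, if_true]
    field_simp
    ring

theorem S_eq_binMap (j : ℕ+) : S j = binMap (List.replicate ((j : ℕ) - 1) true ++ [false]) := by
  funext x
  rw [binMap_append]
  obtain ⟨k, hk⟩ : ∃ k : ℕ, (j : ℕ) = k + 1 := ⟨j - 1, by have := j.pos; omega⟩
  simp only [Function.comp, binMap_replicate_true, S, binMap, binStep, id, hk,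
    Nat.add_sub_cancel, Bool.false_eq_true, if_false]
  rw [pow_succ]
  field_simp
  ring

theorem S_add_eq (i j : ℕ+) : S (i + j) = binMap (List.replicate (i : ℕ) true) ∘ S j := by
  rw [S_eq_binMap, S_eq_binMap, ← binMap_append, ← List.append_assoc, List.replicate_append_replicate]
  congr 4
  have := j.pos
  rw [PNat.add_coe]
  omega

/-! ### P as the Cantor distribution -/

theorem isProbabilityMeasure_P : IsProbabilityMeasure P := isInvariant_P.1

attribute [instance] isProbabilityMeasure_P

theorem P_apply_eq_tsum {A : Set ℝ} (hA : MeasurableSet A) :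
    P A = ∑' j : ℕ+, (1 / 2 : ℝ≥0∞) ^ (j : ℕ) * P.map (S j) A := by
  conv_lhs => rw [isInvariant_P.2]
  rw [Measure.sum_apply _ hA]
  rfl

theorem binStep_true_comp_S (j : ℕ+) : binStep true ∘ S j = S (j + 1) := by
  rw [add_comm, S_add_eq]
  rfl

theorem S_one : S 1 = binStep false := by
  rw [S_eq_binMap]
  rfl

theorem tsum_pnat_eq_add (f : ℕ+ → ℝ≥0∞) : ∑' j, f j = f 1 + ∑' j, f (j + 1) := by
  rw [← Equiv.pnatEquivNat.symm.tsum_eq f, tsum_eq_zero_add' ENNReal.summable,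
    ← Equiv.pnatEquivNat.symm.tsum_eq fun j => f (j + 1)]
  rfl

/-- The term j = 1 of the invariance equation is the T₀ branch. As T₁ ∘ S_j = S_{j+1}, the remaining
terms are half of the same equation, applied to the T₁-preimage. -/
theorem P_eq_map_add_map :
    P = (1 / 2 : ℝ≥0∞) • P.map (binStep false) + (1 / 2 : ℝ≥0∞) • P.map (binStep true) := by
  have hm := fun b => (measurableEmbedding_binStep b).measurable
  refine Measure.ext fun A hA => ?_
  simp only [Measure.coe_add, Measure.coe_smul, Pi.add_apply, Pi.smul_apply, smul_eq_mul]
  rw [P_apply_eq_tsum hA, Measure.map_apply (hm true) hA, P_apply_eq_tsum (hm true hA),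
    tsum_pnat_eq_add, ← ENNReal.tsum_mul_left, S_one]
  congr 1
  · simp
  · refine tsum_congr fun j => ?_
    rw [Measure.map_apply (measurable_S _) (hm true hA), ← Set.preimage_comp, binStep_true_comp_S,
      Measure.map_apply (measurable_S _) hA, ← mul_assoc, ← pow_succ']
    rfl

/-- A probability measure that is invariant under the two Cantor similarities is `P`. -/
theorem eq_P_of_eq_map_add_map {μ : Measure ℝ} [IsProbabilityMeasure μ]
    (h : μ = (1 / 2 : ℝ≥0∞) • μ.map (binStep false) + (1 / 2 : ℝ≥0∞) • μ.map (binStep true)) :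
    μ = P := by
  refine existsUnique_isInvariant.unique ⟨inferInstance, ?_⟩ isInvariant_P
  refine Measure.ext fun A hA => ?_
  have hm := fun b => (measurableEmbedding_binStep b).measurable
  have step : ∀ B, MeasurableSet B →
      μ B = 1 / 2 * μ (binStep false ⁻¹' B) + 1 / 2 * μ (binStep true ⁻¹' B) := by
    intro B hB
    conv_lhs => rw [h]
    simp only [Measure.coe_add, Measure.coe_smul, Pi.add_apply, Pi.smul_apply, smul_eq_mul,
      Measure.map_apply (hm _) hB]
  -- Expanding only the `true` branch N times produces the first N terms of the infinite system and
  -- a remainder of mass at most 2^{-N}.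
  have partialSum : ∀ N : ℕ, μ A = ∑ n ∈ Finset.range N,
      (1 / 2 : ℝ≥0∞) ^ (n + 1) * μ.map (S n.succPNat) A +
        (1 / 2) ^ N * μ (binMap (List.replicate N true) ⁻¹' A) := by
    intro N
    induction N with
    | zero => simp [binMap]
    | succ N ih =>
      rw [ih, step _ ((measurableEmbedding_binMap _).measurable hA), Finset.sum_range_succ,
        ← Set.preimage_comp, ← Set.preimage_comp, add_assoc, mul_add, ← mul_assoc, ← mul_assoc,
        ← pow_succ]
      have h1 : binMap (List.replicate N true) ∘ binStep true =
          binMap (List.replicate (N + 1) true) := by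
        rw [List.replicate_succ', binMap_append]
        rfl
      have h2 : binMap (List.replicate N true) ∘ binStep false = S N.succPNat := by
        rw [S_eq_binMap, binMap_append]
        rfl
      rw [h1, h2, Measure.map_apply (measurable_S _) hA, ← add_assoc]
  have rest : Filter.Tendsto
      (fun N : ℕ => (1 / 2 : ℝ≥0∞) ^ N * μ (binMap (List.replicate N true) ⁻¹' A))
      Filter.atTop (nhds 0) := by
    refine tendsto_of_tendsto_of_tendsto_of_le_of_le tendsto_const_nhds
      (ENNReal.tendsto_pow_atTop_nhds_zero_of_lt_one
        (by simp : (1 / 2 : ℝ≥0∞) < 1)) (fun _ => bot_le) fun N => ?_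
    exact mul_le_of_le_one_right' prob_le_one
  have lim := (ENNReal.tendsto_nat_tsum fun n : ℕ =>
    (1 / 2 : ℝ≥0∞) ^ (n + 1) * μ.map (S n.succPNat) A).add rest
  simp only [← partialSum, add_zero] at lim
  rw [tendsto_nhds_unique tendsto_const_nhds lim, Measure.sum_apply _ hA,
    ← Equiv.pnatEquivNat.symm.tsum_eq]
  rfl

theorem lintegral_P (g : ℝ → ℝ≥0∞) :
    ∫⁻ x, g x ∂P =
      1 / 2 * ∫⁻ x, g (binStep false x) ∂P + 1 / 2 * ∫⁻ x, g (binStep true x) ∂P := by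
  conv_lhs => rw [P_eq_map_add_map]
  rw [lintegral_add_measure, lintegral_smul_measure, lintegral_smul_measure,
    (measurableEmbedding_binStep _).lintegral_map, (measurableEmbedding_binStep _).lintegral_map]
  rfl

theorem P_apply {A : Set ℝ} (hA : MeasurableSet A) :
    P A = 1 / 2 * P (binStep false ⁻¹' A) + 1 / 2 * P (binStep true ⁻¹' A) := by
  have hm := fun b => (measurableEmbedding_binStep b).measurable
  conv_lhs => rw [P_eq_map_add_map]
  simp only [Measure.coe_add, Measure.coe_smul, Pi.add_apply, Pi.smul_apply, smul_eq_mul,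
      Measure.map_apply (hm _) hA]

/-! ### Support, moments and symmetry of P -/

/-- Both similarities contract towards [0,1], so the mass outside the r-neighbourhood is at most the
mass outside the 3r-neighbourhood. Iterating, it is bounded by a quantity tending to 0. -/
theorem P_Icc_compl : P (Set.Icc 0 1)ᶜ = 0 := by
  set A : ℝ → Set ℝ := fun r => (Set.Icc (-r) (1 + r))ᶜ with hA
  have step : ∀ r, 0 ≤ r → P (A r) ≤ P (A (3 * r)) := by
    intro r hr
    have h : ∀ b, binStep b ⁻¹' A r ⊆ A (3 * r) := by
      intro b x hx
      simp only [hA, Set.mem_preimage, Set.mem_compl_iff, Set.mem_Icc, binStep] at hx ⊢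
      contrapose! hx
      cases b <;> simp <;> constructor <;> linarith
    rw [P_apply measurableSet_Icc.compl]
    calc _ ≤ 1 / 2 * P (A (3 * r)) + 1 / 2 * P (A (3 * r)) := by gcongr <;> exact h _
      _ = P (A (3 * r)) := by rw [← add_mul, ENNReal.add_halves, one_mul]
  have iter : ∀ r, 0 ≤ r → ∀ n : ℕ, P (A r) ≤ P (A (3 ^ n * r)) := by
    intro r hr n
    induction n with
    | zero => simp
    | succ n ih =>
      refine ih.trans ((step _ (by positivity)).trans_eq ?_)
      rw [pow_succ', mul_assoc]
  have zero : ∀ r, 0 < r → P (A r) = 0 := by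
    intro r hr
    have anti : Antitone fun n : ℕ => A (3 ^ n * r) := by
      intro m n hmn
      have : (3 : ℝ) ^ m * r ≤ 3 ^ n * r := by gcongr; norm_num
      exact Set.compl_subset_compl.2 (Set.Icc_subset_Icc (by linarith) (by linarith))
    have lim := tendsto_measure_iInter_atTop (μ := P)
      (fun n : ℕ => (measurableSet_Icc.compl.nullMeasurableSet :
        NullMeasurableSet (A (3 ^ n * r)) P)) anti ⟨0, measure_ne_top _ _⟩
    have empty : ⋂ n : ℕ, A (3 ^ n * r) = ∅ := by
      refine Set.eq_empty_of_forall_notMem fun x hx => ?_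
      obtain ⟨n, hn⟩ := pow_unbounded_of_one_lt (|x| / r) (by norm_num : (1 : ℝ) < 3)
      rw [div_lt_iff₀ hr] at hn
      refine Set.mem_iInter.1 hx n ?_
      rw [Set.mem_Icc]
      constructor <;> linarith [neg_abs_le x, le_abs_self x]
    rw [empty, measure_empty] at lim
    exact le_antisymm (ge_of_tendsto' lim (iter r hr.le)) bot_le
  have cover : (Set.Icc (0 : ℝ) 1)ᶜ ⊆ ⋃ n : ℕ, A (1 / (n + 1)) := by
    intro x hx
    rw [Set.mem_compl_iff, Set.mem_Icc, not_and_or, not_le, not_le] at hx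
    obtain ⟨δ, hδ, hx⟩ : ∃ δ : ℝ, 0 < δ ∧ (x ≤ -δ ∨ 1 + δ ≤ x) := by
      rcases hx with hx | hx
      · exact ⟨-x, by linarith, by simp⟩
      · exact ⟨x - 1, by linarith, by simp⟩
    obtain ⟨n, hn⟩ := exists_nat_one_div_lt hδ
    refine Set.mem_iUnion.2 ⟨n, ?_⟩
    rw [hA, Set.mem_compl_iff, Set.mem_Icc]
    rintro ⟨h1, h2⟩
    rcases hx with hx | hx <;> linarith
  exact measure_mono_null cover (measure_iUnion_null fun n => zero _ (by positivity))

theorem ae_mem_Icc : ∀ᵐ x ∂P, x ∈ Set.Icc (0 : ℝ) 1 := P_Icc_compl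

theorem integrable_P_of_continuous {f : ℝ → ℝ} (hf : Continuous f) : Integrable f P := by
  obtain ⟨C, hC⟩ := (isCompact_Icc (a := (0 : ℝ)) (b := 1)).exists_bound_of_continuousOn
    hf.continuousOn
  refine (integrable_const C).mono' hf.aestronglyMeasurable ?_
  filter_upwards [ae_mem_Icc] with x hx using hC x hx

theorem continuous_binStep (b : Bool) : Continuous (binStep b) := by
  unfold binStep; fun_prop

theorem integral_P {f : ℝ → ℝ} (hf : Continuous f) :
    ∫ x, f x ∂P = 1 / 2 * ∫ x, f (binStep false x) ∂P + 1 / 2 * ∫ x, f (binStep true x) ∂P := by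
  have h : ∀ b, Integrable f ((1 / 2 : ℝ≥0∞) • P.map (binStep b)) := fun b => by
    refine Integrable.smul_measure ?_ (by simp)
    rw [(measurableEmbedding_binStep _).integrable_map_iff]
    exact integrable_P_of_continuous (hf.comp (continuous_binStep b))
  conv_lhs => rw [P_eq_map_add_map]
  rw [integral_add_measure (h _) (h _), integral_smul_measure, integral_smul_measure,
    (measurableEmbedding_binStep _).integral_map, (measurableEmbedding_binStep _).integral_map]
  simp

theorem integral_id_P : ∫ x, x ∂P = 1 / 2 := by
  have h := integral_P continuous_id
  have hi : Integrable (fun x : ℝ => x) P := integrable_P_of_continuous continuous_id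
  simp only [id, binStep, Bool.false_eq_true, if_false, if_true, add_zero] at h
  rw [integral_add (hi.div_const 3) (integrable_const _), integral_div, integral_const] at h
  simp at h
  linarith

theorem integral_quadratic_P (a b c : ℝ) :
    ∫ x, a * x ^ 2 + b * x + c ∂P = a * ∫ x, x ^ 2 ∂P + b / 2 + c := by
  have h1 : Integrable (fun x : ℝ => a * x ^ 2 + b * x) P :=
    integrable_P_of_continuous (by fun_prop)
  have h2 : Integrable (fun x : ℝ => a * x ^ 2) P := integrable_P_of_continuous (by fun_prop)
  have h3 : Integrable (fun x : ℝ => b * x) P := integrable_P_of_continuous (by fun_prop)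
  rw [integral_add h1 (integrable_const _), integral_add h2 h3, integral_const_mul,
    integral_const_mul, integral_id_P, integral_const]
  simp
  ring

theorem integral_sq_P : ∫ x, x ^ 2 ∂P = 3 / 8 := by
  have h := integral_P (continuous_pow 2)
  have e1 : ∀ x : ℝ, binStep false x ^ 2 = 1 / 9 * x ^ 2 + 0 * x + 0 := fun x => by
    simp [binStep]; ring
  have e2 : ∀ x : ℝ, binStep true x ^ 2 = 1 / 9 * x ^ 2 + 4 / 9 * x + 4 / 9 := fun x => by
    simp [binStep]; ring
  simp only [e1, e2, integral_quadratic_P] at h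
  linarith

theorem integral_affine_sq_P (u v : ℝ) :
    ∫ x, (u * x + v) ^ 2 ∂P = (u / 2 + v) ^ 2 + u ^ 2 / 8 := by
  have e : ∀ x : ℝ, (u * x + v) ^ 2 = u ^ 2 * x ^ 2 + 2 * u * v * x + v ^ 2 := fun x => by ring
  simp only [e, integral_quadratic_P, integral_sq_P]
  ring

theorem lintegral_affine_sq_P (u v : ℝ) :
    ∫⁻ x, ENNReal.ofReal ((u * x + v) ^ 2) ∂P = ENNReal.ofReal ((u / 2 + v) ^ 2 + u ^ 2 / 8) := by
  rw [← integral_affine_sq_P, ofReal_integral_eq_lintegral_ofReal]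
  · exact integrable_P_of_continuous (by fun_prop)
  · exact Filter.Eventually.of_forall fun x => sq_nonneg _

/-- Reflection exchanges the two branches, so the reflected measure solves the same binary equation,
which has only one solution. -/
theorem map_one_sub_P : P.map (fun x => 1 - x) = P := by
  have hr : Measurable fun x : ℝ => 1 - x := by fun_prop
  have hm := fun b => (measurableEmbedding_binStep b).measurable
  have : IsProbabilityMeasure (P.map fun x => 1 - x) :=
    Measure.isProbabilityMeasure_map hr.aemeasurable
  refine eq_P_of_eq_map_add_map ?_
  conv_lhs => rw [P_eq_map_add_map]
  rw [Measure.map_add _ _ hr, Measure.map_smul, Measure.map_smul, Measure.map_map hr (hm _),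
    Measure.map_map hr (hm _), Measure.map_map (hm _) hr, Measure.map_map (hm _) hr, add_comm]
  congr 3 <;>
  · funext x
    simp [binStep]
    ring

/-! ### Conditional means on Cantor intervals -/

theorem binStep_not_preimage_image (b : Bool) {B : Set ℝ} (hB : B ⊆ Set.Icc 0 1) :
    binStep (!b) ⁻¹' (binStep b '' B) ⊆ (Set.Icc 0 1)ᶜ := by
  rintro x ⟨y, hy, hxy⟩ hx
  have := hB hy
  simp only [Set.mem_Icc] at this hx
  cases b <;> simp [binStep] at hxy <;> linarith

/-- The other branch puts no mass here, because the images of [0,1] under the two similarities are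
disjoint. -/
theorem restrict_binStep_image (b : Bool) {B : Set ℝ} (hB : B ⊆ Set.Icc 0 1) :
    P.restrict (binStep b '' B) = (1 / 2 : ℝ≥0∞) • (P.restrict B).map (binStep b) := by
  have hm := measurableEmbedding_binStep
  have h0 : (P.map (binStep !b)).restrict (binStep b '' B) = 0 := by
    rw [Measure.restrict_eq_zero, (hm _).map_apply]
    exact measure_mono_null (binStep_not_preimage_image b hB) P_Icc_compl
  have h1 : (P.map (binStep b)).restrict (binStep b '' B) = (P.restrict B).map (binStep b) := by
    rw [(hm b).restrict_map, Set.preimage_image_eq _ (hm b).injective]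
  conv_lhs => rw [P_eq_map_add_map]
  rw [Measure.restrict_add, Measure.restrict_smul, Measure.restrict_smul]
  cases b
  · rw [h1]
    simp only [Bool.not_false] at h0
    rw [h0]
    simp
  · rw [h1]
    simp only [Bool.not_true] at h0
    rw [h0]
    simp

theorem binStep_mapsTo (b : Bool) : Set.MapsTo (binStep b) (Set.Icc 0 1) (Set.Icc 0 1) := by
  rintro x ⟨h0, h1⟩
  cases b <;> simp [binStep] <;> constructor <;> linarith

theorem binMap_mapsTo (s : List Bool) : Set.MapsTo (binMap s) (Set.Icc 0 1) (Set.Icc 0 1) := by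
  induction s with
  | nil => exact Set.mapsTo_id _
  | cons b s ih => exact (binStep_mapsTo b).comp ih

theorem restrict_binMap_image (s : List Bool) {B : Set ℝ} (hB : B ⊆ Set.Icc 0 1) :
    P.restrict (binMap s '' B) =
      (1 / 2 : ℝ≥0∞) ^ s.length • (P.restrict B).map (binMap s) := by
  induction s with
  | nil => simp [binMap]
  | cons b s ih =>
    have hs : binMap s '' B ⊆ Set.Icc 0 1 :=
      (Set.image_mono hB).trans (binMap_mapsTo s).image_subset
    rw [binMap, Set.image_comp, restrict_binStep_image b hs, ih, Measure.map_smul, smul_smul,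
      Measure.map_map (measurableEmbedding_binStep b).measurable
        (measurableEmbedding_binMap s).measurable, List.length_cons, pow_succ']

theorem binMap_eq (s : List Bool) (x : ℝ) :
    binMap s x = 1 / 3 ^ s.length * x + binMap s 0 := by
  have := binMap_sub s x 0
  linear_combination this

theorem integral_binMap (s : List Bool) : ∫ x, binMap s x ∂P = binMap s (1 / 2) := by
  have e : ∀ x, binMap s x = 0 * x ^ 2 + 1 / 3 ^ s.length * x + binMap s 0 := fun x => by
    rw [binMap_eq s x]; ring
  rw [integral_congr_ae (Filter.Eventually.of_forall e), integral_quadratic_P, e (1 / 2)]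
  ring

/-- Conditioned on the image, P is its own affine copy, so the mean 1/2 is carried along. Allowing
any B of full measure covers J_{(ω,∞)}, which is not a full interval. -/
theorem condMean_binMap_image (s : List Bool) {B : Set ℝ} (hB : B ⊆ Set.Icc 0 1) (h1 : P Bᶜ = 0) :
    condMean (binMap s '' B) = binMap s (1 / 2) := by
  have hr : P.restrict B = P := Measure.restrict_eq_self_of_ae_mem h1
  have h := restrict_binMap_image s hB
  rw [hr] at h
  have hu : P (binMap s '' B) = (1 / 2 : ℝ≥0∞) ^ s.length := by
    have := congrArg (fun μ : Measure ℝ => μ Set.univ) h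
    simp only [Measure.restrict_apply_univ, Measure.smul_apply,
      (measurableEmbedding_binMap s).map_apply, Set.preimage_univ, measure_univ, smul_eq_mul,
      mul_one] at this
    exact this
  rw [condMean, h, integral_smul_measure, (measurableEmbedding_binMap s).integral_map,
    integral_binMap, measureReal_def, hu, smul_eq_mul, ← mul_assoc, inv_mul_cancel₀, one_mul]
  rw [ENNReal.toReal_pow]
  exact pow_ne_zero _ (by simp)

/-! ### Distortion on cells -/

/-- The squared distance from `x` to `α`, with value in `[0, ∞]`. -/
noncomputable def sqDist (α : Set ℝ) (x : ℝ) : ℝ≥0∞ := ⨅ a ∈ α, ENNReal.ofReal ((x - a) ^ 2)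

/-- The distortion of `α` on the image of `P` under `x ↦ u x + v`. -/
noncomputable def cellDistortion (α : Set ℝ) (u v : ℝ) : ℝ≥0∞ := ∫⁻ x, sqDist α (u * x + v) ∂P

theorem cellDistortion_one_zero (α : Set ℝ) : cellDistortion α 1 0 = distortion P α := by
  simp [cellDistortion, distortion, sqDist]

theorem cellDistortion_split (α : Set ℝ) (u v : ℝ) :
    cellDistortion α u v = 1 / 2 * cellDistortion α (u / 3) v +
      1 / 2 * cellDistortion α (u / 3) (v + 2 * u / 3) := by
  rw [cellDistortion, lintegral_P]
  simp only [binStep, cellDistortion, Bool.false_eq_true, if_false, if_true]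
  congr! 5 <;> ring

theorem half_mul_ofReal_add (p q : ℝ) :
    ENNReal.ofReal ((p + q) / 2) ≤
      1 / 2 * ENNReal.ofReal p + 1 / 2 * ENNReal.ofReal q := by
  have h : (1 / 2 : ℝ≥0∞) = ENNReal.ofReal (1 / 2) := by
    rw [ENNReal.ofReal_div_of_pos (by norm_num)]; simp
  rw [h, ← mul_add]
  calc _ = ENNReal.ofReal (1 / 2) * ENNReal.ofReal (p + q) := by
        rw [← ENNReal.ofReal_mul (by norm_num)]; congr 1; ring
    _ ≤ _ := by gcongr; exact ENNReal.ofReal_add_le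

/-- Cell distortions are normalised to mass one, so each subdivision halves the weights. The new
cell enters through equations, so that explicit fractions can be supplied. -/
theorem le_cellDistortion_of_split {α : Set ℝ} {u v u' v' k p q : ℝ} (hu : u' = u / 3)
    (hv : v' = v + 2 * u / 3) (hk : k ≤ (p + q) / 2)
    (hp : ENNReal.ofReal p ≤ cellDistortion α u' v)
    (hq : ENNReal.ofReal q ≤ cellDistortion α u' v') :
    ENNReal.ofReal k ≤ cellDistortion α u v := by
  subst hu hv
  rw [cellDistortion_split]
  refine (ENNReal.ofReal_le_ofReal hk).trans ((half_mul_ofReal_add p q).trans ?_)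
  gcongr

theorem zero_le_cellDistortion (α : Set ℝ) (u v : ℝ) :
    ENNReal.ofReal 0 ≤ cellDistortion α u v := by simp

/-- If on the cell no point of `α` is closer than `c`, then the distortion on the cell is at least
that of `{c}`. -/
theorem le_cellDistortion_of_point {α : Set ℝ} {u v k : ℝ} (c : ℝ)
    (hk : k ≤ (u / 2 + v - c) ^ 2 + u ^ 2 / 8)
    (h : ∀ x ∈ Set.Icc (0 : ℝ) 1, ∀ a ∈ α, (u * x + v - c) ^ 2 ≤ (u * x + v - a) ^ 2) :
    ENNReal.ofReal k ≤ cellDistortion α u v := by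
  have e := lintegral_affine_sq_P u (v - c)
  rw [← add_sub_assoc] at e
  refine (ENNReal.ofReal_le_ofReal hk).trans (e.symm.le.trans (lintegral_mono_ae ?_))
  filter_upwards [ae_mem_Icc] with x hx
  refine le_iInf₂ fun a ha => ENNReal.ofReal_le_ofReal ?_
  rw [← add_sub_assoc]
  exact h x hx a ha

theorem le_cellDistortion_of_const {α : Set ℝ} {u v k : ℝ}
    (h : ∀ x ∈ Set.Icc (0 : ℝ) 1, ∀ a ∈ α, k ≤ (u * x + v - a) ^ 2) :
    ENNReal.ofReal k ≤ cellDistortion α u v := by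
  have e : ENNReal.ofReal k = ∫⁻ _, ENNReal.ofReal k ∂P := by simp
  rw [e]
  refine lintegral_mono_ae ?_
  filter_upwards [ae_mem_Icc] with x hx
  exact le_iInf₂ fun a ha => ENNReal.ofReal_le_ofReal (h x hx a ha)

/-- If on the cell the points of `β` are as good as those of `α`, then the distortion on the cell
is at least the rescaled distortion of the rescaled `β`. -/
theorem le_cellDistortion_of_image {α β : Set ℝ} {u v : ℝ} (hu : u ≠ 0)
    (h : ∀ x ∈ Set.Icc (0 : ℝ) 1, ∀ a ∈ α, ∃ b ∈ β, (u * x + v - b) ^ 2 ≤ (u * x + v - a) ^ 2) :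
    ENNReal.ofReal (u ^ 2) * distortion P ((fun b => (b - v) / u) '' β) ≤ cellDistortion α u v := by
  rw [distortion, ← lintegral_const_mul' _ _ ENNReal.ofReal_ne_top]
  refine lintegral_mono_ae ?_
  filter_upwards [ae_mem_Icc] with x hx
  refine le_iInf₂ fun a ha => ?_
  obtain ⟨b, hb, hab⟩ := h x hx a ha
  calc _ ≤ ENNReal.ofReal (u ^ 2) * ENNReal.ofReal ((x - (b - v) / u) ^ 2) := by
        gcongr
        exact iInf₂_le ((b - v) / u) ⟨b, hb, rfl⟩
    _ = ENNReal.ofReal ((u * x + v - b) ^ 2) := by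
        rw [← ENNReal.ofReal_mul (sq_nonneg u)]
        congr 1
        field_simp
        ring
    _ ≤ _ := ENNReal.ofReal_le_ofReal hab

theorem distortion_one_sub (α : Set ℝ) :
    distortion P ((fun x => 1 - x) '' α) = distortion P α := by
  have hm : MeasurableEmbedding fun x : ℝ => 1 - x := by
    have := measurableEmbedding_affine (u := -1) (by norm_num) 1
    convert this using 2 with x
    ring
  conv_lhs => rw [distortion, ← map_one_sub_P, hm.lintegral_map]
  refine lintegral_congr fun x => ?_
  rw [iInf_image]
  refine iInf_congr fun a => iInf_congr fun _ => ?_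
  congr 1
  ring

theorem le_distortion_empty (k : ℝ) : ENNReal.ofReal k ≤ distortion P ∅ := by
  simp [distortion]

/-- The points farther from x than c are those beyond c and those beyond its mirror image 2x - c. -/
theorem sq_le_sq_of_between {x c a : ℝ} (h : c ≤ x ∧ (a ≤ c ∨ 2 * x - c ≤ a) ∨
    x ≤ c ∧ (c ≤ a ∨ a ≤ 2 * x - c)) : (x - c) ^ 2 ≤ (x - a) ^ 2 := by
  rcases h with ⟨h1, h2 | h2⟩ | ⟨h1, h2 | h2⟩ <;> nlinarith

theorem le_distortion_of_card_eq_one {α : Finset ℝ} (h : α.card = 1) :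
    ENNReal.ofReal (1 / 8) ≤ distortion P α := by
  obtain ⟨c, rfl⟩ := Finset.card_eq_one.1 h
  rw [← cellDistortion_one_zero]
  refine le_cellDistortion_of_point c (by nlinarith [sq_nonneg (1 / 2 - c)]) ?_
  simp

/-! ### Sets with a point whose Voronoi region meets both halves -/

/-- `a` is a point of `α` in the right half, and no point of `α` lies strictly between `2 / 3 - a`
and `a`. -/
def HasGap (α : Set ℝ) (a : ℝ) : Prop := a ∈ α ∧ 1 / 2 ≤ a ∧ ∀ b ∈ α, a ≤ b ∨ b ≤ 2 / 3 - a

/-- The points 2/3-θ and θ are mirror images in 1/3, so on [2/9, 1/3] the point 2/3-θ beats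
everything outside the gap. The constant is its mean squared error on that cell. -/
theorem HasGap.le_cellDistortion {α : Set ℝ} {a θ : ℝ} (h : HasGap α a) (hθ : 1 / 2 ≤ θ)
    (ha : θ ≤ a) :
    ENNReal.ofReal ((θ - 7 / 18) ^ 2 + 1 / 648) ≤ cellDistortion α (1 / 9) (2 / 9) := by
  refine le_cellDistortion_of_point (2 / 3 - θ) (by nlinarith) fun x hx b hb => ?_
  have := hx.2
  refine sq_le_sq_of_between (Or.inl ⟨by linarith [hx.1], ?_⟩)
  rcases h.2.2 b hb with h | h
  · right; linarith
  · left; linarith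

/-- The cell [2/9, 1/3] has mass 1/4 and the right third mass 1/2; the cell [0, 1/9] is discarded.
-/
theorem HasGap.le_distortion {α : Set ℝ} {a θ p q k : ℝ} (h : HasGap α a) (hθ : 1 / 2 ≤ θ)
    (ha : θ ≤ a) (hp : p ≤ ((θ - 7 / 18) ^ 2 + 1 / 648) / 4) (hk : k ≤ p + q / 2)
    (hq : ENNReal.ofReal q ≤ cellDistortion α (1 / 3) (2 / 3)) :
    ENNReal.ofReal k ≤ distortion P α := by
  rw [← cellDistortion_one_zero]
  refine le_cellDistortion_of_split (by norm_num) (by norm_num) (p := 2 * p) (by linarith) ?_ hq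
  exact le_cellDistortion_of_split (by norm_num) (by norm_num) (by linarith)
    (zero_le_cellDistortion _ _ _) (h.le_cellDistortion hθ ha)

theorem le_distortion_of_half_le {α : Set ℝ} (h : ∀ b ∈ α, 1 / 2 ≤ b) :
    ENNReal.ofReal (1 / 16) ≤ distortion P α := by
  rw [← cellDistortion_one_zero]
  refine le_cellDistortion_of_split (u' := 1 / 3) (v' := 2 / 3) (by norm_num) (by norm_num)
    (p := 1 / 8) (q := 0) (by norm_num) ?_ (zero_le_cellDistortion _ _ _)
  refine le_cellDistortion_of_point (1 / 2) (by norm_num) fun x hx b hb => ?_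
  have := hx.2
  exact sq_le_sq_of_between (Or.inr ⟨by linarith, Or.inl (h b hb)⟩)

theorem HasGap.le_distortion_pair {a b : ℝ} (h : HasGap {a, b} a) :
    ENNReal.ofReal (1 / 72) ≤ distortion P {a, b} := by
  rcases h.2.2 b (by simp) with hb | hb
  · refine (ENNReal.ofReal_le_ofReal (by norm_num)).trans (le_distortion_of_half_le ?_)
    rintro e (rfl | rfl)
    exacts [h.2.1, h.2.1.trans hb]
  have h1 := h.2.1
  have right : ∀ x ∈ Set.Icc (0 : ℝ) 1, ∀ d ∈ ({a, b} : Set ℝ),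
      (1 / 3 * x + 2 / 3 - a) ^ 2 ≤ (1 / 3 * x + 2 / 3 - d) ^ 2 := by
    rintro x ⟨hx, -⟩ d (rfl | rfl)
    · exact le_rfl
    · rcases le_total a (1 / 3 * x + 2 / 3) with hc | hc
      · exact sq_le_sq_of_between (Or.inl ⟨hc, Or.inl (by linarith)⟩)
      · exact sq_le_sq_of_between (Or.inr ⟨hc, Or.inr (by linarith)⟩)
  -- From 61/108 on, the gap alone costs at least 10/1296, and the variance 1/72 of the right third
  -- supplies the rest.
  rcases le_total (61 / 108) a with ha | ha
  · refine h.le_distortion (p := 10 / 1296) (q := 1 / 72) (by norm_num) ha (by norm_num)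
      (by norm_num) ?_
    exact le_cellDistortion_of_point a (by nlinarith [sq_nonneg (1 / 3 / 2 + 2 / 3 - a)]) right
  -- Here a is so far from 5/6, the centre of the right third, that the right third alone suffices.
  · refine h.le_distortion (θ := 1 / 2) (p := 0) (q := 1 / 36) (by norm_num) h1 (by norm_num)
      (by norm_num) ?_
    exact le_cellDistortion_of_point a (by nlinarith) right

/-- The distortion on the right half of a set with at most one point to the right of `61 / 108`. -/
theorem le_cellDistortion_right {α : Set ℝ} {c : ℝ} (h : ∀ b ∈ α, b ≤ 61 / 108 ∨ b = c) :
    ENNReal.ofReal (11 / 1296) ≤ cellDistortion α (1 / 3) (2 / 3) := by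
  -- If c is this far left, the cell [8/9, 1] alone is expensive enough.
  rcases le_total c (22 / 27) with h1 | h1
  · refine le_cellDistortion_of_split (by norm_num) (by norm_num) (p := 0) (q := 22 / 1296)
      (by norm_num) (zero_le_cellDistortion _ _ _)
      (le_cellDistortion_of_point (22 / 27) (by norm_num) fun x hx b hb => ?_) (v' := 8 / 9)
      (u' := 1 / 9)
    have := hx.1
    refine sq_le_sq_of_between (Or.inl ⟨by linarith, Or.inl ?_⟩)
    rcases h b hb with h | rfl <;> linarith
  -- 99/108 is the mirror image of 61/108 in 20/27. It decides whether c is nearest on all of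
  -- [20/27, 7/9].
  rcases le_total c (99 / 108) with h2 | h2
  · refine le_cellDistortion_of_split (u' := 1 / 9) (v' := 8 / 9) (by norm_num) (by norm_num)
      (p := ((11 / 108) ^ 2 + ((41 / 54 - c) ^ 2)) / 2) (q := (17 / 18 - c) ^ 2 + 1 / 648)
      -- The weighted sum of squares is minimal at c = 143/162.
      (by nlinarith [sq_nonneg (c - 143 / 162)]) ?_ ?_
    · refine le_cellDistortion_of_split (u' := 1 / 27) (v' := 20 / 27) (by norm_num) (by norm_num)
        le_rfl (le_cellDistortion_of_const fun x hx b hb => ?_)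
        (le_cellDistortion_of_point c (by norm_num) fun x hx b hb => ?_)
      · have := hx.1
        have := hx.2
        rcases h b hb with h | rfl
        · nlinarith
        · nlinarith
      · have := hx.1
        have := hx.2
        rcases h b hb with h | rfl
        · exact sq_le_sq_of_between (Or.inr ⟨by linarith, Or.inr (by linarith)⟩)
        · exact le_rfl
    · refine le_cellDistortion_of_point c (by linarith) fun x hx b hb => ?_
      have := hx.1
      rcases h b hb with h | rfl
      · rcases le_total c (1 / 9 * x + 8 / 9) with hc | hc
        · exact sq_le_sq_of_between (Or.inl ⟨hc, Or.inl (by linarith)⟩)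
        · exact sq_le_sq_of_between (Or.inr ⟨hc, Or.inr (by linarith)⟩)
      · exact le_rfl
  · refine le_cellDistortion_of_split (u' := 1 / 9) (v' := 8 / 9) (by norm_num) (by norm_num)
      (p := ((13 / 108) ^ 2 + (17 / 108) ^ 2) / 2) (q := 0)
      (by norm_num) ?_ (zero_le_cellDistortion _ _ _)
    refine le_cellDistortion_of_split (u' := 1 / 27) (v' := 20 / 27) (by norm_num) (by norm_num)
      le_rfl (le_cellDistortion_of_point (61 / 108) (by norm_num) fun x hx b hb => ?_)
      (le_cellDistortion_of_point (99 / 108) (by norm_num) fun x hx b hb => ?_)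
    · have := hx.1
      have := hx.2
      refine sq_le_sq_of_between (Or.inl ⟨by linarith, ?_⟩)
      rcases h b hb with h | rfl
      · left; linarith
      · right; linarith
    · have := hx.1
      have := hx.2
      refine sq_le_sq_of_between (Or.inr ⟨by linarith, ?_⟩)
      rcases h b hb with h | rfl
      · right; linarith
      · left; linarith

/-- The bound 10/1296 is the exact three-point error. A far gap pays for it alone; a near one leaves
at most one useful point for the right third, unless all points are in the right half. -/
theorem HasGap.le_distortion_triple {a b c : ℝ} (h : HasGap {a, b, c} a) :
    ENNReal.ofReal (10 / 1296) ≤ distortion P {a, b, c} := by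
  have h1 := h.2.1
  rcases le_total (61 / 108) a with ha | ha
  · exact h.le_distortion (p := 10 / 1296) (q := 0) (by norm_num) ha (by norm_num) (by norm_num)
      (zero_le_cellDistortion _ _ _)
  have key : ∀ d, (∀ e ∈ ({a, b, c} : Set ℝ), e ≤ 61 / 108 ∨ e = d) →
      ENNReal.ofReal (10 / 1296) ≤ distortion P {a, b, c} := fun d hd =>
    -- 9/2592 is the least cost of any gap; 11/1296, weighted by 1/2, is exactly what is missing
    -- from 10/1296.
    h.le_distortion (θ := 1 / 2) (p := 9 / 2592) (q := 11 / 1296) (by norm_num) h1 (by norm_num)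
      (by norm_num) (le_cellDistortion_right hd)
  rcases h.2.2 b (by simp) with hb | hb
  · rcases h.2.2 c (by simp) with hc | hc
    · refine (ENNReal.ofReal_le_ofReal (by norm_num)).trans (le_distortion_of_half_le ?_)
      rintro e (rfl | rfl | rfl)
      exacts [h1, h1.trans hb, h1.trans hc]
    · refine key b ?_
      rintro e (rfl | rfl | rfl)
      exacts [Or.inl ha, Or.inr rfl, Or.inl (by linarith)]
  · refine key c ?_
    rintro e (rfl | rfl | rfl)
    exacts [Or.inl ha, Or.inl (by linarith), Or.inr rfl]

/-! ### The lower bound -/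

/-- The affine function of `n` that agrees with the `n`th quantization error for
`2 ^ l ≤ n ≤ 2 ^ (l + 1)`. -/
noncomputable def errorLine (l n : ℕ) : ℝ := (17 * 2 ^ l - 8 * n) / (72 * 18 ^ l)

/-- From level 3 on, dropping the term in n leaves at most 17/(72·9³), so four numerical checks
cover all lines. -/
theorem errorLine_le {l n : ℕ} {k : ℝ} (h0 : errorLine 0 n ≤ k) (h1 : errorLine 1 n ≤ k)
    (h2 : errorLine 2 n ≤ k) (hk : 17 / (72 * 729) ≤ k) : errorLine l n ≤ k := by
  match l with
  | 0 => exact h0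
  | 1 => exact h1
  | 2 => exact h2
  | l + 3 =>
    refine le_trans ?_ hk
    have h9 : (1 : ℝ) ≤ 9 ^ l := one_le_pow₀ (by norm_num)
    have h18 : (18 : ℝ) ^ (l + 3) = 729 * 2 ^ (l + 3) * 9 ^ l := by
      rw [show (18 : ℝ) = 2 * 9 by norm_num, mul_pow, pow_add 9]; ring
    have h2 : (0 : ℝ) < 2 ^ (l + 3) := by positivity
    rw [errorLine, div_le_div_iff₀ (by positivity) (by positivity), h18]
    have : (0 : ℝ) ≤ n := by positivity
    nlinarith [mul_le_mul_of_nonneg_left h9 h2.le]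

theorem HasGap.errorLine_le_distortion {α : Finset ℝ} {a : ℝ} (h : HasGap α a) (l : ℕ) :
    ENNReal.ofReal (errorLine l α.card) ≤ distortion P α := by
  have ha : a ∈ α := h.1
  suffices ∃ k, errorLine l α.card ≤ k ∧ ENNReal.ofReal k ≤ distortion P α by
    obtain ⟨k, h1, h2⟩ := this
    exact (ENNReal.ofReal_le_ofReal h1).trans h2
  have hcard := Finset.card_erase_add_one ha
  have hins : (α : Set ℝ) = insert a ((α.erase a : Finset ℝ) : Set ℝ) := by
    rw [← Finset.coe_insert, Finset.insert_erase ha]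
  rcases hn : (α.erase a).card with _ | _ | _ | m
  · refine ⟨_, ?_, le_distortion_of_card_eq_one (by omega)⟩
    rw [show α.card = 1 by omega]
    apply errorLine_le <;> norm_num [errorLine]
  · obtain ⟨b, hb⟩ := Finset.card_eq_one.1 hn
    rw [hb, Finset.coe_singleton] at hins
    rw [hins] at h ⊢
    refine ⟨_, ?_, h.le_distortion_pair⟩
    rw [show α.card = 2 by omega]
    apply errorLine_le <;> norm_num [errorLine]
  · obtain ⟨b, c, -, hb⟩ := Finset.card_eq_two.1 hn
    rw [hb, Finset.coe_pair] at hins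
    rw [hins] at h ⊢
    refine ⟨_, ?_, h.le_distortion_triple⟩
    rw [show α.card = 3 by omega]
    apply errorLine_le <;> norm_num [errorLine]
  -- With four or more points any gap is already too costly: every line is at most 1/648 there.
  · refine ⟨1 / 288, ?_, h.le_distortion (θ := 1 / 2) (p := 1 / 288) (q := 0) (by norm_num) h.2.1
      (by norm_num) (by norm_num) (zero_le_cellDistortion _ _ _)⟩
    rw [show α.card = m + 4 by omega]
    have : (0 : ℝ) ≤ m := by positivity
    apply errorLine_le <;> norm_num [errorLine] <;> linarith

/-- Either the two halves are served by disjoint parts of `α`, or `α` or its reflection has a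
gap. -/
theorem exists_split_or_hasGap (α : Finset ℝ) :
    (∃ β γ : Finset ℝ, β.card + γ.card = α.card ∧
      ENNReal.ofReal (1 / 18) * (distortion P β + distortion P γ) ≤ distortion P α) ∨
    (∃ a, HasGap α a) ∨ ∃ a, HasGap ((fun x => 1 - x) '' (α : Set ℝ)) a := by
  classical
  set β := α.filter (· ≤ 1 / 2) with hβ
  set γ := α.filter (1 / 2 < ·) with hγ
  by_cases hA : ∀ x ∈ Set.Icc (0 : ℝ) 1, ∀ a ∈ α, ∃ b ∈ β,
      (1 / 3 * x + 0 - b) ^ 2 ≤ (1 / 3 * x + 0 - a) ^ 2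
  swap
  · right; left
    push Not at hA
    obtain ⟨x, hx, a, ha, h⟩ := hA
    have hx1 := hx.2
    have haγ : a ∈ γ := by
      rw [hγ, Finset.mem_filter]
      refine ⟨ha, ?_⟩
      by_contra hcon
      exact lt_irrefl _ (h a (by rw [hβ, Finset.mem_filter]; exact ⟨ha, not_lt.1 hcon⟩))
    obtain ⟨m, hm, hmin⟩ := γ.exists_min_image id ⟨a, haγ⟩
    have hma : m ≤ a := hmin a haγ
    rw [hγ, Finset.mem_filter] at hm
    refine ⟨m, hm.1, hm.2.le, fun b hb => ?_⟩
    rcases le_or_gt b (1 / 2) with hb2 | hb2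
    -- The witness in [0, 1/3] is strictly nearer to a than to b < a, hence lies to the right of
    -- (a+b)/2. So b < 2/3 - a ≤ 2/3 - m.
    · right
      have := h b (by rw [hβ, Finset.mem_filter]; exact ⟨hb, hb2⟩)
      by_contra hcon
      rw [not_le] at hcon
      nlinarith
    · left
      exact hmin b (by rw [hγ, Finset.mem_filter]; exact ⟨hb, hb2⟩)
  by_cases hB : ∀ x ∈ Set.Icc (0 : ℝ) 1, ∀ a ∈ α, ∃ b ∈ γ,
      (1 / 3 * x + 2 / 3 - b) ^ 2 ≤ (1 / 3 * x + 2 / 3 - a) ^ 2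
  swap
  · right; right
    push Not at hB
    obtain ⟨x, hx, a, ha, h⟩ := hB
    have hx0 := hx.1
    have haβ : a ∈ β := by
      rw [hβ, Finset.mem_filter]
      refine ⟨ha, ?_⟩
      by_contra hcon
      exact lt_irrefl _ (h a (by rw [hγ, Finset.mem_filter]; exact ⟨ha, not_le.1 hcon⟩))
    obtain ⟨m, hm, hmax⟩ := β.exists_max_image id ⟨a, haβ⟩
    have hma : a ≤ m := hmax a haβ
    rw [hβ, Finset.mem_filter] at hm
    refine ⟨1 - m, ⟨m, hm.1, rfl⟩, by linarith [hm.2], ?_⟩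
    rintro _ ⟨b, hb, rfl⟩
    rcases le_or_gt b (1 / 2) with hb2 | hb2
    · left
      have : b ≤ m := hmax b (by rw [hβ, Finset.mem_filter]; exact ⟨hb, hb2⟩)
      linarith
    · right
      have := h b (by rw [hγ, Finset.mem_filter]; exact ⟨hb, hb2⟩)
      by_contra hcon
      rw [not_le] at hcon
      nlinarith [hm.2]
  left
  have scale_inj : ∀ v : ℝ, Function.Injective fun b : ℝ => (b - v) / (1 / 3) := by
    intro v x y hxy
    simp only at hxy
    linarith
  refine ⟨β.image fun b => (b - 0) / (1 / 3), γ.image fun b => (b - 2 / 3) / (1 / 3), ?_, ?_⟩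
  · rw [Finset.card_image_of_injective _ (scale_inj _), Finset.card_image_of_injective _ (scale_inj _),
      hβ, hγ, ← Finset.card_filter_add_card_filter_not (s := α) (· ≤ 1 / 2)]
    simp only [not_le]
  · have h1 := le_cellDistortion_of_image (α := α) (β := β) (by norm_num) hA
    have h2 := le_cellDistortion_of_image (α := α) (β := γ) (by norm_num) hB
    have e : ENNReal.ofReal (1 / 18) = 1 / 2 * ENNReal.ofReal ((1 / 3) ^ 2) := by
      rw [← ENNReal.ofReal_one, ← ENNReal.ofReal_ofNat 2, ← ENNReal.ofReal_div_of_pos (by norm_num),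
        ← ENNReal.ofReal_mul (by norm_num)]
      norm_num
    rw [← cellDistortion_one_zero α, cellDistortion_split, e, mul_add, mul_assoc, mul_assoc,
      Finset.coe_image, Finset.coe_image]
    norm_num at h1 h2 ⊢
    gcongr

theorem errorLine_le_distortion_of_split {l : ℕ} {α β γ : Finset ℝ} {p q : ℝ}
    (hle : ENNReal.ofReal (1 / 18) * (distortion P β + distortion P γ) ≤ distortion P α)
    (hp : ENNReal.ofReal p ≤ distortion P β) (hq : ENNReal.ofReal q ≤ distortion P γ)
    (h : errorLine l α.card ≤ 1 / 18 * (p + q)) :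
    ENNReal.ofReal (errorLine l α.card) ≤ distortion P α := by
  refine le_trans ?_ hle
  refine (ENNReal.ofReal_le_ofReal h).trans ?_
  rw [ENNReal.ofReal_mul (by norm_num)]
  gcongr
  exact ENNReal.ofReal_add_le.trans (add_le_add hp hq)

theorem errorLine_le_distortion (l : ℕ) (α : Finset ℝ) :
    ENNReal.ofReal (errorLine l α.card) ≤ distortion P α := by
  classical
  induction l generalizing α with
  | zero =>
    rcases hn : α.card with _ | _ | _ | m
    · rw [Finset.card_eq_zero.1 hn, Finset.coe_empty]
      exact le_distortion_empty _
    · convert le_distortion_of_card_eq_one hn using 2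
      norm_num [errorLine]
    · rw [← hn]
      rcases exists_split_or_hasGap α with ⟨β, γ, hc, hle⟩ | ⟨a, h⟩ | ⟨a, h⟩
      · have hc1 : ∀ δ : Finset ℝ, δ.card ≤ 1 → ENNReal.ofReal (1 / 8) ≤ distortion P δ := by
          intro δ hδ
          rcases Nat.le_one_iff_eq_zero_or_eq_one.1 hδ with h | h
          · rw [Finset.card_eq_zero.1 h, Finset.coe_empty]
            exact le_distortion_empty _
          · exact le_distortion_of_card_eq_one h
        have e : errorLine 0 α.card = 1 / 72 := by rw [hn]; norm_num [errorLine]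
        rcases Nat.lt_trichotomy β.card 1 with hb | hb | hb
        · rw [Nat.lt_one_iff, Finset.card_eq_zero] at hb
          -- An empty part has infinite distortion; 1/4 is the finite amount needed, since (1/4)/18
          -- = 1/72.
          refine errorLine_le_distortion_of_split hle (p := 1 / 4) (q := 0)
            (by rw [hb, Finset.coe_empty]; exact le_distortion_empty _) (by simp) ?_
          rw [e]; norm_num
        · refine errorLine_le_distortion_of_split hle (hc1 β hb.le) (hc1 γ (by omega)) ?_
          rw [e]; norm_num
        · have hg : γ = ∅ := by rw [← Finset.card_eq_zero]; omega
          refine errorLine_le_distortion_of_split hle (p := 0) (q := 1 / 4) (by simp)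
            (by rw [hg, Finset.coe_empty]; exact le_distortion_empty _) ?_
          rw [e]; norm_num
      · exact h.errorLine_le_distortion 0
      · rw [← Finset.coe_image] at h
        have := h.errorLine_le_distortion 0
        rwa [Finset.card_image_of_injective _ (fun x y hxy => by simpa using hxy),
          Finset.coe_image, distortion_one_sub] at this
    · rw [ENNReal.ofReal_of_nonpos]
      · exact bot_le
      · have : (0 : ℝ) ≤ m := by positivity
        simp only [errorLine]
        push_cast
        norm_num
        linarith
  | succ l ih =>
    rcases exists_split_or_hasGap α with ⟨β, γ, hc, hle⟩ | ⟨a, h⟩ | ⟨a, h⟩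
    -- The recursion is an equality for every distribution of points between the halves, so no case
    -- analysis on the cardinalities is needed.
    · refine errorLine_le_distortion_of_split hle (ih β) (ih γ) (le_of_eq ?_)
      rw [← hc]
      simp only [errorLine]
      push_cast
      rw [pow_succ, pow_succ]
      field_simp
      ring
    · exact h.errorLine_le_distortion _
    · rw [← Finset.coe_image] at h
      have := h.errorLine_le_distortion (l + 1)
      rwa [Finset.card_image_of_injective _ (fun x y hxy => by simpa using hxy),
        Finset.coe_image, distortion_one_sub] at this

/-! ### Binary words -/

/-- The point 1/2 lies in the removed middle third, while the midpoint of a nonempty word lies in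
the outer third given by its first digit. -/
theorem binMap_half_injective : Function.Injective fun s : List Bool => binMap s (1 / 2) := by
  have hhalf : (1 / 2 : ℝ) ∈ Set.Icc (0 : ℝ) 1 := by constructor <;> norm_num
  have hcons : ∀ b s, binMap (b :: s) (1 / 2) = binStep b (binMap s (1 / 2)) := fun _ _ => rfl
  intro s
  induction s with
  | nil =>
    rintro (_ | ⟨b, t⟩) h
    · rfl
    · have := binMap_mapsTo t hhalf
      simp only [hcons] at h
      cases b <;> simp [binMap, binStep] at h this <;> linarith
  | cons b s ih =>
    have hs := binMap_mapsTo s hhalf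
    rintro (_ | ⟨c, t⟩) h
    · simp only [hcons] at h
      cases b <;> simp [binMap, binStep] at h hs <;> linarith
    · have ht := binMap_mapsTo t hhalf
      simp only [hcons] at h
      have hbc : b = c := by
        cases b <;> cases c <;> simp [binStep] at h hs ht ⊢ <;> linarith
      subst hbc
      rw [ih ((measurableEmbedding_binStep b).injective h)]

/-- The binary words of length `l`. -/
def binWords : ℕ → Finset (List Bool)
  | 0 => {[]}
  | l + 1 => (binWords l).map ⟨List.cons false, List.cons_injective⟩ ∪
      (binWords l).map ⟨List.cons true, List.cons_injective⟩

theorem mem_binWords {l : ℕ} {s : List Bool} : s ∈ binWords l ↔ s.length = l := by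
  induction l generalizing s with
  | zero => simp [binWords]
  | succ l ih =>
    cases s with
    | nil => simp [binWords]
    | cons b s => cases b <;> simp [binWords, ih]

theorem disjoint_cons_binWords (l : ℕ) :
    Disjoint ((binWords l).map ⟨List.cons false, List.cons_injective⟩)
      ((binWords l).map ⟨List.cons true, List.cons_injective⟩) := by
  rw [Finset.disjoint_left]
  simp

theorem sum_binWords_succ {M : Type*} [AddCommMonoid M] (l : ℕ) (f : List Bool → M) :
    ∑ s ∈ binWords (l + 1), f s =
      ∑ s ∈ binWords l, f (false :: s) + ∑ s ∈ binWords l, f (true :: s) := by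
  rw [binWords, Finset.sum_union (disjoint_cons_binWords l)]
  simp

theorem card_binWords (l : ℕ) : (binWords l).card = 2 ^ l := by
  rw [Finset.card_eq_sum_ones]
  induction l with
  | zero => simp [binWords]
  | succ l ih => rw [sum_binWords_succ, ih, pow_succ]; ring

/-- The midpoints of the level `l` intervals of the Cantor set. -/
noncomputable def midpoints (l : ℕ) : Finset ℝ :=
  (binWords l).image fun s => binMap s (1 / 2)

theorem card_midpoints (l : ℕ) : (midpoints l).card = 2 ^ l := by
  rw [midpoints, Finset.card_image_of_injective _ binMap_half_injective, card_binWords]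

theorem binMap_half_mem_midpoints {l : ℕ} {s : List Bool} :
    binMap s (1 / 2) ∈ midpoints l ↔ s.length = l := by
  rw [midpoints, ← mem_binWords]
  exact binMap_half_injective.mem_finset_image

/-! ### Words over the positive integers as binary words -/

/-- The binary word of `S_ω`. -/
def enc : List ℕ+ → List Bool
  | [] => []
  | j :: w => List.replicate ((j : ℕ) - 1) true ++ false :: enc w

/-- The binary word of the interval spanned by `J_{(ω, ∞)}`. -/
def encTail : List ℕ+ → List Bool
  | [] => []
  | [i] => List.replicate (i : ℕ) true
  | i :: k :: w => List.replicate ((i : ℕ) - 1) true ++ false :: encTail (k :: w)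

theorem S_comp_binMap (j : ℕ+) (s : List Bool) :
    S j ∘ binMap s = binMap (List.replicate ((j : ℕ) - 1) true ++ false :: s) := by
  rw [S_eq_binMap, ← binMap_append, List.append_assoc]
  rfl

theorem wordMap_eq (w : List ℕ+) : wordMap w = binMap (enc w) := by
  induction w with
  | nil => rfl
  | cons j w ih => rw [wordMap, ih, S_comp_binMap, enc]

/-- Because S_{i+j} = T₁^i ∘ S_j, all cylinders forming J_{(ω,∞)} share one binary prefix, which
`encTail` records. -/
theorem wordMap_shiftLast (w : List ℕ+) (hw : w ≠ []) (j : ℕ+) :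
    wordMap (shiftLast w j) = binMap (encTail w) ∘ S j := by
  induction w with
  | nil => exact absurd rfl hw
  | cons i w ih =>
    cases w with
    | nil => rw [shiftLast, encTail, ← S_add_eq]; rfl
    | cons k w =>
      rw [shiftLast, wordMap, ih (by simp), ← Function.comp_assoc, S_comp_binMap, encTail]

theorem a_eq (w : List ℕ+) : a w = binMap (enc w) (1 / 2) := by
  rw [a, cylinder, wordMap_eq, condMean_binMap_image _ subset_rfl P_Icc_compl]

theorem S_mapsTo (j : ℕ+) : Set.MapsTo (S j) (Set.Icc 0 1) (Set.Icc 0 1) := by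
  rw [S_eq_binMap]
  exact binMap_mapsTo _

theorem P_iUnion_image_S_compl : P (⋃ j : ℕ+, S j '' Set.Icc 0 1)ᶜ = 0 := by
  have hm : MeasurableSet (⋃ j : ℕ+, S j '' Set.Icc 0 1) :=
    MeasurableSet.iUnion fun j => by
      rw [S_eq_binMap]
      exact (measurableEmbedding_binMap _).measurableSet_image.2 measurableSet_Icc
  rw [P_apply_eq_tsum hm.compl, ENNReal.tsum_eq_zero]
  intro j
  rw [Measure.map_apply (measurable_S j) hm.compl, measure_mono_null _ P_Icc_compl, mul_zero]
  rw [Set.preimage_compl, Set.compl_subset_compl]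
  exact fun x hx => Set.mem_iUnion.2 ⟨j, x, hx, rfl⟩

theorem aTail_eq {w : List ℕ+} (hw : w ≠ []) : aTail w = binMap (encTail w) (1 / 2) := by
  have h : cylinderTail w = binMap (encTail w) '' ⋃ j : ℕ+, S j '' Set.Icc 0 1 := by
    rw [cylinderTail, Set.image_iUnion]
    refine Set.iUnion_congr fun j => ?_
    rw [cylinder, wordMap_shiftLast w hw, Set.image_comp]
  rw [aTail, h, condMean_binMap_image _ _ P_iUnion_image_S_compl]
  exact Set.iUnion_subset fun j => (S_mapsTo j).image_subset

theorem wordProb_eq (w : List ℕ+) : wordProb w = 1 / 2 ^ (enc w).length := by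
  induction w with
  | nil => simp [wordProb, enc]
  | cons j w ih =>
    have hj := j.pos
    have e : (enc (j :: w)).length = j + (enc w).length := by
      simp [enc]; omega
    have e2 : wordProb (j :: w) = 1 / 2 ^ (j : ℕ) * wordProb w := by simp [wordProb]
    rw [e, pow_add, e2, ih]
    field_simp

theorem length_encTail (w : List ℕ+) : (encTail w).length = (enc w).length := by
  induction w with
  | nil => rfl
  | cons i w ih =>
    have hi := i.pos
    cases w with
    | nil => simp [enc, encTail]; omega
    | cons k w =>
      rw [enc, encTail, List.length_append, List.length_append, List.length_cons, List.length_cons,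
        ih]

theorem wordProb_eq_iff (w : List ℕ+) (l : ℕ) : wordProb w = 1 / 2 ^ l ↔ (enc w).length = l := by
  rw [wordProb_eq, one_div, one_div, inv_inj]
  exact pow_right_injective₀ (by norm_num) (by norm_num) |>.eq_iff

/-- A final `false` corresponds to `enc` and a final `true` to `encTail`. Prepending `false` adds
the letter 1; prepending `true` raises the first letter by one. -/
theorem exists_enc_or_encTail (s : List Bool) (hs : s ≠ []) :
    ∃ w : List ℕ+, w ≠ [] ∧ (s = enc w ∨ s = encTail w) := by
  induction s with
  | nil => exact absurd rfl hs
  | cons b s ih =>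
    by_cases h : s = []
    · subst h
      cases b
      · exact ⟨[1], by simp, Or.inl rfl⟩
      · exact ⟨[1], by simp, Or.inr rfl⟩
    · obtain ⟨w, hw, hws⟩ := ih h
      cases b
      · refine ⟨1 :: w, by simp, hws.imp (fun h => by rw [h]; rfl) fun h => ?_⟩
        obtain ⟨k, w, rfl⟩ := List.exists_cons_of_ne_nil hw
        rw [h]
        rfl
      · obtain ⟨k, w, rfl⟩ := List.exists_cons_of_ne_nil hw
        have e : ((k + 1 : ℕ+) : ℕ) - 1 = (k : ℕ) - 1 + 1 := by
          have := k.pos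
          rw [PNat.add_coe, PNat.one_coe]
          omega
        refine ⟨(k + 1) :: w, by simp, hws.imp (fun h => ?_) fun h => ?_⟩
        · rw [h, enc, enc, e, List.replicate_succ, List.cons_append]
        · cases w with
          | nil => rw [h, encTail, encTail, PNat.add_coe, PNat.one_coe, List.replicate_succ]
          | cons i w => rw [h, encTail, encTail, e, List.replicate_succ, List.cons_append]

theorem alpha_eq {l : ℕ} (hl : l ≠ 0) : alpha l = midpoints l := by
  ext x
  simp only [alpha, Set.mem_union, Set.mem_ofPred_eq, wordProb_eq_iff, Finset.mem_coe]
  constructor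
  · rintro (⟨w, hw, rfl⟩ | ⟨w, hw, rfl⟩)
    · rwa [a_eq, binMap_half_mem_midpoints]
    -- Level at least 1 excludes the empty word, for which a(ω,∞) is meaningless.
    · have hne : w ≠ [] := by
        rintro rfl
        exact hl hw.symm
      rwa [aTail_eq hne, binMap_half_mem_midpoints, length_encTail]
  · intro hx
    obtain ⟨s, hs, rfl⟩ := Finset.mem_image.1 hx
    rw [mem_binWords] at hs
    obtain ⟨w, hw, rfl | rfl⟩ := exists_enc_or_encTail s (by rintro rfl; exact hl hs.symm)
    · exact Or.inl ⟨w, hs, (a_eq w).symm⟩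
    · exact Or.inr ⟨w, by rw [← length_encTail, hs], (aTail_eq hw).symm⟩

theorem enc_append_one (w : List ℕ+) : enc (w ++ [1]) = enc w ++ [false] := by
  induction w with
  | nil => rfl
  | cons j w ih => simp [enc, ih]

theorem encTail_append_one (w : List ℕ+) : encTail (w ++ [1]) = enc w ++ [true] := by
  induction w with
  | nil => rfl
  | cons j w ih =>
    obtain ⟨k, v, h⟩ := List.exists_cons_of_ne_nil (show w ++ [1] ≠ [] by simp)
    rw [List.cons_append, h, encTail, ← h, ih, enc, List.append_assoc, List.cons_append]

theorem enc_shiftLast_one {w : List ℕ+} (hw : w ≠ []) :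
    enc (shiftLast w 1) = encTail w ++ [false] := by
  induction w with
  | nil => exact absurd rfl hw
  | cons i w ih =>
    cases w with
    | nil => simp [shiftLast, enc, encTail]
    | cons k w =>
      rw [shiftLast, enc, ih (by simp), encTail, List.append_assoc, List.cons_append]

theorem shiftLast_ne_nil {w : List ℕ+} (hw : w ≠ []) (j : ℕ+) : shiftLast w j ≠ [] := by
  match w with
  | [] => exact absurd rfl hw
  | [i] => simp [shiftLast]
  | i :: k :: w => simp [shiftLast]

theorem encTail_shiftLast_one {w : List ℕ+} (hw : w ≠ []) :
    encTail (shiftLast w 1) = encTail w ++ [true] := by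
  induction w with
  | nil => exact absurd rfl hw
  | cons i w ih =>
    cases w with
    | nil => simp [shiftLast, encTail, List.replicate_succ']
    | cons k w =>
      obtain ⟨m, v, h⟩ := List.exists_cons_of_ne_nil (shiftLast_ne_nil (w := k :: w) (by simp) 1)
      rw [shiftLast, h, encTail, ← h, ih (by simp), encTail, List.append_assoc, List.cons_append]

/-- In binary coding both kinds of splitting are one operation: append `false` and append `true`. -/
theorem alphaSplit_eq {l : ℕ} (hl : l ≠ 0) {I : Set ℝ} (hI : I ⊆ midpoints l) :
    alphaSplit l I = (↑(midpoints l) \ I) ∪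
      {x | ∃ s b, binMap s (1 / 2) ∈ I ∧ x = binMap (s ++ [b]) (1 / 2)} := by
  rw [alphaSplit, alpha_eq hl]
  simp only [Set.union_assoc]
  congr 1
  ext x
  simp only [Set.mem_union, Set.mem_ofPred_eq]
  constructor
  · rintro (⟨w, hw, rfl⟩ | ⟨w, hw, rfl⟩ | ⟨w, hne, hw, rfl⟩ | ⟨w, hne, hw, rfl⟩)
    · exact ⟨enc w, false, by rwa [← a_eq], by rw [a_eq, enc_append_one]⟩
    · exact ⟨enc w, true, by rwa [← a_eq], by rw [aTail_eq (by simp), encTail_append_one]⟩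
    · exact ⟨encTail w, false, by rwa [← aTail_eq hne], by rw [a_eq, enc_shiftLast_one hne]⟩
    · exact ⟨encTail w, true, by rwa [← aTail_eq hne],
        by rw [aTail_eq (shiftLast_ne_nil hne 1), encTail_shiftLast_one hne]⟩
  · rintro ⟨s, b, hs, rfl⟩
    have hlen := binMap_half_mem_midpoints.1 (hI hs)
    obtain ⟨w, hw, rfl | rfl⟩ := exists_enc_or_encTail s (by rintro rfl; exact hl hlen.symm)
    · cases b
      · exact Or.inl ⟨w, by rwa [a_eq], by rw [a_eq, enc_append_one]⟩
      · exact Or.inr (Or.inl ⟨w, by rwa [a_eq], by rw [aTail_eq (by simp), encTail_append_one]⟩)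
    · cases b
      · exact Or.inr (Or.inr (Or.inl ⟨w, hw, by rwa [aTail_eq hw],
          by rw [a_eq, enc_shiftLast_one hw]⟩))
      · exact Or.inr (Or.inr (Or.inr ⟨w, hw, by rwa [aTail_eq hw],
          by rw [aTail_eq (shiftLast_ne_nil hw 1), encTail_shiftLast_one hw]⟩))

/-! ### The sets `α_n(I)` -/

/-- The new points are midpoints of level l+1, hence never of level l. So I can be read off from
α_n(I), and distinct I give distinct sets. -/
theorem midpoints_diff_alphaSplit {l : ℕ} (hl : l ≠ 0) {I : Set ℝ} (hI : I ⊆ midpoints l) :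
    ↑(midpoints l) \ alphaSplit l I = I := by
  rw [alphaSplit_eq hl hI]
  ext x
  simp only [Set.mem_sdiff, Set.mem_union, Set.mem_ofPred_eq, not_or, not_and, not_not]
  refine ⟨fun h => h.2.1 h.1, fun h => ⟨hI h, fun _ => h, ?_⟩⟩
  rintro ⟨s, b, hs, rfl⟩
  have h1 := binMap_half_mem_midpoints.1 (hI hs)
  have h2 := binMap_half_mem_midpoints.1 (hI h)
  rw [List.length_append, h1, List.length_singleton] at h2
  omega

theorem ncard_alphaSplit {l : ℕ} (hl : l ≠ 0) (k : ℕ) :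
    {α : Set ℝ | ∃ I : Finset ℝ, (I : Set ℝ) ⊆ alpha l ∧ I.card = k ∧
      α = alphaSplit l (I : Set ℝ)}.ncard = (2 ^ l).choose k := by
  have e : {α : Set ℝ | ∃ I : Finset ℝ, (I : Set ℝ) ⊆ alpha l ∧ I.card = k ∧
      α = alphaSplit l (I : Set ℝ)} =
      (fun I : Finset ℝ => alphaSplit l (I : Set ℝ)) '' ((midpoints l).powersetCard k) := by
    ext α
    simp only [alpha_eq hl, Set.mem_ofPred_eq, Set.mem_image, Finset.mem_coe,
      Finset.mem_powersetCard, Finset.coe_subset, and_assoc, eq_comm (a := α)]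
  rw [e, Set.InjOn.ncard_image, Set.ncard_coe_finset, Finset.card_powersetCard, card_midpoints]
  intro I hI J hJ h
  rw [Finset.mem_coe, Finset.mem_powersetCard] at hI hJ
  rw [← Finset.coe_inj, ← midpoints_diff_alphaSplit hl (Finset.coe_subset.2 hI.1),
    ← midpoints_diff_alphaSplit hl (Finset.coe_subset.2 hJ.1)]
  simp only at h
  rw [h]

theorem encard_alphaSplit_le {l : ℕ} (hl : l ≠ 0) {I : Finset ℝ} (hI : I ⊆ midpoints l) :
    (alphaSplit l (I : Set ℝ)).encard ≤ ((2 ^ l + I.card : ℕ) : ℕ∞) := by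
  classical
  set W := (binWords l).filter fun s => binMap s (1 / 2) ∈ I with hW
  have hWI : W.card ≤ I.card :=
    Finset.card_le_card_of_injOn (fun s => binMap s (1 / 2))
      (fun s hs => (Finset.mem_filter.1 hs).2) binMap_half_injective.injOn
  have hsub : alphaSplit l (I : Set ℝ) ⊆ (((midpoints l \ I) ∪
      (W ×ˢ Finset.univ).image fun p : List Bool × Bool => binMap (p.1 ++ [p.2]) (1 / 2) :
        Finset ℝ) : Set ℝ) := by
    rw [alphaSplit_eq hl (Finset.coe_subset.2 hI)]
    rintro x (hx | ⟨s, b, hs, rfl⟩)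
    · simp only [Finset.coe_union, Finset.coe_sdiff]
      exact Or.inl hx
    · rw [Finset.mem_coe, Finset.mem_union]
      refine Or.inr (Finset.mem_image.2 ⟨(s, b), ?_, rfl⟩)
      rw [Finset.mem_product, hW, Finset.mem_filter, mem_binWords]
      exact ⟨⟨binMap_half_mem_midpoints.1 (hI hs), hs⟩, Finset.mem_univ b⟩
  refine (Set.encard_le_encard hsub).trans ?_
  rw [Set.encard_coe_eq_coe_finsetCard, Nat.cast_le]
  have h1 := Finset.card_sdiff_add_card_eq_card hI
  rw [card_midpoints] at h1
  calc _ ≤ (midpoints l \ I).card + (W ×ˢ (Finset.univ : Finset Bool)).card :=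
        (Finset.card_union_le _ _).trans (Nat.add_le_add_left Finset.card_image_le _)
    _ ≤ _ := by
        rw [Finset.card_product, Finset.card_univ, Fintype.card_bool]
        omega

/-! ### The upper bound -/

theorem lintegral_P_eq_sum (l : ℕ) (g : ℝ → ℝ≥0∞) :
    ∫⁻ x, g x ∂P = (1 / 2) ^ l * ∑ s ∈ binWords l, ∫⁻ x, g (binMap s x) ∂P := by
  induction l generalizing g with
  | zero => simp [binWords, binMap]
  | succ l ih =>
    rw [lintegral_P, ih (fun x => g (binStep false x)), ih (fun x => g (binStep true x)),
      sum_binWords_succ, ← mul_assoc, ← mul_assoc, ← pow_succ', ← mul_add]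
    rfl

theorem lintegral_sqDist_binMap_le {α : Set ℝ} {s : List Bool} (h : binMap s (1 / 2) ∈ α) :
    ∫⁻ x, sqDist α (binMap s x) ∂P ≤ ENNReal.ofReal (1 / 9 ^ s.length / 8) := by
  have e := lintegral_affine_sq_P (1 / 3 ^ s.length) (-(1 / 3 ^ s.length / 2))
  have e2 : (1 / 3 ^ s.length / 2 + -(1 / 3 ^ s.length / 2)) ^ 2 + (1 / 3 ^ s.length) ^ 2 / 8 =
      (1 / 9 ^ s.length / 8 : ℝ) := by
    rw [show (9 : ℝ) = 3 ^ 2 by norm_num, ← pow_mul, mul_comm 2, pow_mul]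
    field_simp
    ring
  rw [e2] at e
  rw [← e]
  refine lintegral_mono fun x => (iInf₂_le _ h).trans_eq ?_
  rw [binMap_sub]
  congr 2
  ring

theorem lintegral_sqDist_binMap_le_of_children {α : Set ℝ} {s : List Bool}
    (h : ∀ b, binMap (s ++ [b]) (1 / 2) ∈ α) :
    ∫⁻ x, sqDist α (binMap s x) ∂P ≤ ENNReal.ofReal (1 / 9 ^ s.length / 72) := by
  have hb : ∀ b, ∫⁻ x, sqDist α (binMap s (binStep b x)) ∂P ≤
      ENNReal.ofReal (1 / 9 ^ s.length / 72) := by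
    intro b
    have := lintegral_sqDist_binMap_le (h b)
    rw [binMap_append] at this
    refine this.trans_eq ?_
    rw [List.length_append, List.length_singleton, pow_succ]
    congr 1
    field_simp
    norm_num
  rw [lintegral_P]
  calc _ ≤ 1 / 2 * ENNReal.ofReal (1 / 9 ^ s.length / 72) +
        1 / 2 * ENNReal.ofReal (1 / 9 ^ s.length / 72) := by gcongr <;> exact hb _
    _ = _ := by rw [← add_mul, ENNReal.add_halves, one_mul]

theorem distortion_alphaSplit_le {l : ℕ} (hl : l ≠ 0) {I : Finset ℝ} (hI : I ⊆ midpoints l) :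
    distortion P (alphaSplit l (I : Set ℝ)) ≤ ENNReal.ofReal (errorLine l (2 ^ l + I.card)) := by
  classical
  have bound : ∀ s ∈ binWords l, ∫⁻ x, sqDist (alphaSplit l (I : Set ℝ)) (binMap s x) ∂P ≤
      -- Splitting lowers the bound on a cell from 9^{-l}/8 to 9^{-l}/72, a saving of 9^{-l}/9.
      ENNReal.ofReal (1 / 9 ^ l / 8 - if binMap s (1 / 2) ∈ I then 1 / 9 ^ l / 9 else 0) := by
    intro s hs
    rw [mem_binWords] at hs
    split_ifs with h
    · refine (lintegral_sqDist_binMap_le_of_children fun b => ?_).trans_eq ?_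
      · rw [alphaSplit_eq hl (Finset.coe_subset.2 hI)]
        exact Or.inr ⟨s, b, h, rfl⟩
      · rw [hs]
        congr 1
        ring
    · rw [sub_zero]
      refine (lintegral_sqDist_binMap_le ?_).trans_eq (by rw [hs])
      rw [alphaSplit_eq hl (Finset.coe_subset.2 hI)]
      exact Or.inl ⟨binMap_half_mem_midpoints.2 hs, h⟩
  have nonneg : ∀ s ∈ binWords l,
      (0 : ℝ) ≤ 1 / 9 ^ l / 8 - if binMap s (1 / 2) ∈ I then 1 / 9 ^ l / 9 else 0 := by
    intro s _
    have : (0 : ℝ) ≤ 1 / 9 ^ l := by positivity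
    split_ifs <;> linarith
  have hcount : ∑ s ∈ binWords l, (if binMap s (1 / 2) ∈ I then (1 / 9 ^ l / 9 : ℝ) else 0) =
      I.card * (1 / 9 ^ l / 9) := by
    have : ∑ x ∈ midpoints l, (if x ∈ I then (1 / 9 ^ l / 9 : ℝ) else 0) =
        I.card * (1 / 9 ^ l / 9) := by
      rw [← Finset.sum_filter, Finset.filter_mem_eq_inter, Finset.inter_eq_right.2 hI,
        Finset.sum_const, nsmul_eq_mul]
    rw [← this, midpoints, Finset.sum_image binMap_half_injective.injOn]
  have half : (1 / 2 : ℝ≥0∞) = ENNReal.ofReal (1 / 2) := by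
    rw [ENNReal.ofReal_div_of_pos (by norm_num)]; simp
  change ∫⁻ x, sqDist _ x ∂P ≤ _
  rw [lintegral_P_eq_sum l]
  calc _ ≤ (1 / 2) ^ l * ∑ s ∈ binWords l, ENNReal.ofReal
        (1 / 9 ^ l / 8 - if binMap s (1 / 2) ∈ I then 1 / 9 ^ l / 9 else 0) := by
        gcongr with s hs
        exact bound s hs
    _ = _ := by
        rw [← ENNReal.ofReal_sum_of_nonneg nonneg, Finset.sum_sub_distrib, hcount,
          Finset.sum_const, card_binWords, half, ← ENNReal.ofReal_pow (by norm_num),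
          ← ENNReal.ofReal_mul (by positivity)]
        congr 1
        rw [errorLine, show (18 : ℝ) = 2 * 9 by norm_num, mul_pow, nsmul_eq_mul]
        push_cast
        rw [one_div_pow]
        field_simp
        ring

theorem quantizationError_le {μ : Measure ℝ} {n : ℕ} {α : Set ℝ} (h : α.encard ≤ n) :
    quantizationError μ n ≤ distortion μ α :=
  iInf₂_le (f := fun (α : Set ℝ) (_ : α.encard ≤ n) => distortion μ α) α h

theorem errorLine_le_quantizationError (l n : ℕ) :
    ENNReal.ofReal (errorLine l n) ≤ quantizationError P n := by
  refine le_iInf₂ fun α hα => ?_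
  have hfin : α.Finite := Set.finite_of_encard_le_coe hα
  rw [← hfin.coe_toFinset] at hα ⊢
  rw [Set.encard_coe_eq_coe_finsetCard, Nat.cast_le] at hα
  -- The line decreases in n, so sets with fewer than n points are covered as well.
  refine le_trans (ENNReal.ofReal_le_ofReal ?_) (errorLine_le_distortion l _)
  unfold errorLine
  gcongr

end CantorQuantization

theorem theorem1 (n l : ℕ) (hn : 2 ≤ n) (hl : 2 ^ l ≤ n) (hl' : n < 2 ^ (l + 1)) :
    (∀ I : Finset ℝ, (I : Set ℝ) ⊆ CantorQuantization.alpha l → I.card = n - 2 ^ l →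
      CantorQuantization.IsOptimalSet CantorQuantization.P n
        (CantorQuantization.alphaSplit l (I : Set ℝ))) ∧
    CantorQuantization.quantizationError CantorQuantization.P n =
      ENNReal.ofReal
        (1 / 18 ^ l * (1 / 8) * (2 ^ (l + 1) - (n : ℝ) + 1 / 9 * ((n : ℝ) - 2 ^ l))) ∧
    {α : Set ℝ | ∃ I : Finset ℝ, (I : Set ℝ) ⊆ CantorQuantization.alpha l ∧
        I.card = n - 2 ^ l ∧ α = CantorQuantization.alphaSplit l (I : Set ℝ)}.ncard =
      (2 ^ l).choose (n - 2 ^ l) := by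
  open CantorQuantization in
  have hl0 : l ≠ 0 := by
    rintro rfl
    omega
  have main : ∀ I : Finset ℝ, (I : Set ℝ) ⊆ alpha l → I.card = n - 2 ^ l →
      (alphaSplit l (I : Set ℝ)).encard ≤ n ∧
      distortion P (alphaSplit l (I : Set ℝ)) ≤ ENNReal.ofReal (errorLine l n) := by
    intro I hI hc
    rw [alpha_eq hl0, Finset.coe_subset] at hI
    have e : 2 ^ l + I.card = n := by omega
    have h1 := encard_alphaSplit_le hl0 hI
    have h2 := distortion_alphaSplit_le hl0 hI
    rw [e] at h1 h2
    exact ⟨h1, h2⟩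
  have lower := errorLine_le_quantizationError l n
  refine ⟨fun I hI hc => ?_, ?_, ncard_alphaSplit hl0 _⟩
  · obtain ⟨h1, h2⟩ := main I hI hc
    exact ⟨h1, le_antisymm (h2.trans lower) (quantizationError_le h1)⟩
  -- The value of the error requires at least one admissible I, which exists because n - 2^l ≤ 2^l.
  · obtain ⟨I, hI, hc⟩ := Finset.exists_subset_card_eq
      (show n - 2 ^ l ≤ (midpoints l).card by rw [card_midpoints]; rw [pow_succ] at hl'; omega)
    obtain ⟨h1, h2⟩ := main I (by rw [alpha_eq hl0]; exact Finset.coe_subset.2 hI) hc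
    rw [le_antisymm ((quantizationError_le h1).trans h2) lower, errorLine]
    congr 1
    rw [pow_succ]
    field_simp
    ring
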